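/- For a word $w=w_1\cdots w_k$ over $\{a,b\}$, the \emph{exponent} of $w$ is the largest integer $d\ge 1$ such that $w=u^d$ for some word $u$. Let $\mathbf a,\mathbf b:[n]\to[n]$ be independent uniformly random functions and $\mathbf w=\phi_{w_k}\circ\cdots\circ\phi_{w_1}$, where $\phi_a=\mathbf a$, $\phi_b=\mathbf b$. Let $C_n^j(\mathbf w)$ be the number of cycles of length $j$ of $\mathbf w$, that is, of sequences $(i_1,\dots,i_j)$ of distinct elements of $[n]$ with $\mathbf w(i_1)=i_2,\dots,\mathbf w(i_{j-1})=i_j,\ \mathbf w(i_j)=i_1$, counted up to cyclic rotation. For $g\ge1$ and $z=(z_0,\dots,z_{g-1})\in\mathbb C^g$ put $$D_n(L,g;z)=\sum_{j=1}^{L} z_{(j\bmod g)}\,C_n^j(\mathbf w),\qquad \rho(d,g;z)=\frac1{\mathrm{lcm}(d,g)}\sum_{r=1}^{\mathrm{lcm}(d,g)} z_{(r\bmod g)}\,\bigl|\{c\ge 1: c\mid d,\ \gcd(c,r)=1\}\bigr|.$$ \textbf{Theorem.} Let $w$ be a (non-empty) word of exponent $d$, let $g\ge1$ and $z\in\mathbb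 C^g$. Write $X_{n,L}=D_n(L,g;z)/\log L$ for $L\ge2$ and $\rho=\rho(d,g;z)$. Then $\lim_{L\to\infty}\lim_{n\to\infty}X_{n,L}=\rho$ in each of the following senses. 1. In distribution: for every $L\ge2$ the law of $X_{n,L}$ converges weakly, as $n\to\infty$, to a probability measure $\nu_L$ on $\mathbb C$, and $\nu_L$ converges weakly to $\delta_\rho$ as $L\to\infty$. 2. In expectation: for every $L\ge2$ the limit $\lim_{n\to\infty}\mathbb E[X_{n,L}]$ exists, and $\lim_{L\to\infty}\lim_{n\to\infty}\mathbb E[X_{n,L}]=\rho$. 3. In probability (bivariate sense): for every $\epsilon>0$ and every $L\ge2$ the limit $\lim_{n\to\infty}\mathbb P(|X_{n,L}-\rho|>\epsilon)$ exists, and $\lim_{L\to\infty}\lim_{n\to\infty}\mathbb P(|X_{n,L}-\rho|>\epsilon)=0$. -/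

import Mathlib

open MeasureTheory ProbabilityTheory Filter Topology

namespace RandomWord

/-- The two-letter alphabet `{a, b}`; a word is a `List Letter`. -/
inductive Letter : Type
  | a : Letter
  | b : Letter

/-- The power `u^m` of a word: the concatenation of `m` copies of `u`. -/
def wordPow (u : List Letter) (m : ℕ) : List Letter :=
  (List.replicate m u).flatten

/-- `d` is the exponent of `w`: the largest integer `d ≥ 1` such that `w` is a `d`-th power.
The empty word has no exponent. -/
def HasExponent (w : List Letter) (d : ℕ) : Prop :=
  IsGreatest {m : ℕ | 1 ≤ m ∧ ∃ u : List Letter, w = wordPow u m} d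

/-- The function attached to a letter. -/
def letterMap {α : Type*} (fa fb : α → α) : Letter → α → α
  | Letter.a => fa
  | Letter.b => fb

/-- The `w`-transition `φ_{w_k} ∘ ⋯ ∘ φ_{w_1}`, where `φ_a = fa` and `φ_b = fb`
(the first letter of `w` acts first). -/
def wordMap {α : Type*} (fa fb : α → α) : List Letter → α → α
  | [] => id
  | c :: w => wordMap fa fb w ∘ letterMap fa fb c

/-- The number of cycles of length `ℓ ≥ 1` of `f`: sequences `(i_1, …, i_ℓ)` of distinct points
with `f i_j = i_{j+1}` and `f i_ℓ = i_1`, counted up to cyclic rotation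
(`Cycle α` is the type of lists up to rotation, and `Cycle.Chain` includes the pair
formed by the last and the first entry). -/
noncomputable def cycleCount {α : Type*} (f : α → α) (ℓ : ℕ) : ℕ :=
  Set.ncard {s : Cycle α | s.Nodup ∧ s.length = ℓ ∧ s.Chain (fun x y => f x = y)}

/-- The set counted in `cycleCount` is finite on a finite type, so that its `ncard` is
its true cardinality. -/
theorem finite_cycles {α : Type*} [Finite α] (f : α → α) (ℓ : ℕ) :
    {s : Cycle α | s.Nodup ∧ s.length = ℓ ∧ s.Chain (fun x y => f x = y)}.Finite := by
  classical
  have := Fintype.ofFinite α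
  have h : Finite {s : Cycle α // s.Nodup} := inferInstance
  exact (Set.toFinite (Set.range (Subtype.val : {s : Cycle α // s.Nodup} → Cycle α))).subset
    fun s hs => ⟨⟨s, hs.1⟩, rfl⟩

/-- The sample space: pairs `(𝐚, 𝐛)` of functions from an `n`-element set to itself. -/
abbrev Sample (n : ℕ) : Type := (Fin n → Fin n) × (Fin n → Fin n)

/-- The law of `(𝐚, 𝐛)`: two independent uniform random functions. -/
noncomputable def law (n : ℕ) : Measure (Sample n) :=
  (uniformOn (Set.univ : Set (Fin n → Fin n))).prod
    (uniformOn (Set.univ : Set (Fin n → Fin n)))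

instance instIsProbabilityMeasureLaw (n : ℕ) : IsProbabilityMeasure (law n) := by
  have : IsProbabilityMeasure (uniformOn (Set.univ : Set (Fin n → Fin n))) :=
    isProbabilityMeasure_uniformOn Set.finite_univ ⟨id, Set.mem_univ _⟩
  unfold law
  infer_instance

/-- The weighted cycle count `D_n(L, g; z) = ∑_{j = 1}^{L} z_{j mod g} C_n^j(𝐰)`, as a random
variable (`Fin.ofNat g j` is `j mod g`). -/
noncomputable def weightedCount (w : List Letter) (g : ℕ) [NeZero g] (z : Fin g → ℂ) (n L : ℕ)
    (ω : Sample n) : ℂ :=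
  ∑ j ∈ Finset.Icc 1 L, z (Fin.ofNat g j) * (cycleCount (wordMap ω.1 ω.2 w) j : ℂ)

/-- The normalised random variable `D_n(L, g; z) / log L`. -/
noncomputable def normCount (w : List Letter) (g : ℕ) [NeZero g] (z : Fin g → ℂ) (n L : ℕ)
    (ω : Sample n) : ℂ :=
  weightedCount w g z n L ω / ((Real.log (L : ℝ) : ℝ) : ℂ)

/-- Every random variable on the (finite, discrete) sample space is measurable. -/
theorem measurable_sample {n : ℕ} (X : Sample n → ℂ) : Measurable X :=
  measurable_of_finite X

/-- Every random variable on the sample space is integrable. -/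
theorem integrable_sample {n : ℕ} (X : Sample n → ℂ) : Integrable X (law n) :=
  Integrable.of_finite

/-- The distribution of `D_n(L, g; z) / log L`, a probability measure on `ℂ`. -/
noncomputable def normCountLaw (w : List Letter) (g : ℕ) [NeZero g] (z : Fin g → ℂ) (n L : ℕ) :
    ProbabilityMeasure ℂ :=
  ⟨(law n).map (normCount w g z n L),
    Measure.isProbabilityMeasure_map (measurable_sample _).aemeasurable⟩

/-- `ρ(d, g; z) = (1 / lcm(d, g)) ∑_{r = 1}^{lcm(d, g)} z_{r mod g} #{c ∣ d : gcd(c, r) = 1}`. -/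
noncomputable def rho (d g : ℕ) [NeZero g] (z : Fin g → ℂ) : ℂ :=
  (1 / (Nat.lcm d g : ℂ)) * ∑ r ∈ Finset.Icc 1 (Nat.lcm d g),
    z (Fin.ofNat g r) * ((d.divisors.filter fun c => Nat.gcd c r = 1).card : ℂ)

/-- The iterated limit `lim_{L → ∞} lim_{n → ∞} x n L = l`: for every `L ≥ 2` (where `log L ≠ 0`)
the limit in `n` exists, and these limits converge to `l` as `L → ∞`. -/
def IteratedLimit {E : Type*} [TopologicalSpace E] (x : ℕ → ℕ → E) (l : E) : Prop :=
  ∃ y : ℕ → E, (∀ L : ℕ, 2 ≤ L → Tendsto (fun n => x n L) atTop (𝓝 (y L))) ∧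
    Tendsto y atTop (𝓝 l)

end RandomWord

/-! Write `w = u ^ d` with `u` primitive and let `f` be the transition of `u`, so that the
transition of `w` is `f^[d]`. A cycle of `f` of length m breaks under `f^[d]` into gcd(m, d) cycles
of length m / gcd(m, d) (`cycleCount_iterate`). For fixed L the normalised count is thus a fixed
linear functional of the numbers C_m of m-cycles of `f`, m ≤ L d.

As n → ∞ these C_m become independent Poisson variables of means 1/m. The proof uses factorial
moments, which count tuples of points on distinct cycles of `f` (`card_isCycleTuple`). Follow a
tuple letter by letter through its T positions, and compare the number v of distinct points met with
the number e ≥ v of distinct (point, letter) pairs. An injective walk is realised with probability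
n^(-T), and there are n(n-1)⋯(n-T+1) of them: they contribute 1 in the limit. Walks with e > v
contribute O(1/n). If e = v, each point is left by a single letter, so trajectories that meet read
the same letters ever after; primitivity aligns their phases in `u`, and the walk turns out to be
injective (`IsPrimitive.tupleTrajectory_injective`). Bonferroni's inequalities convert the moments
into joint Poisson convergence (`tendsto_measureReal_of_factorialMoments`).

Then L → ∞. Replacing C_m by 1/m gives the mean (1 / log L) ∑_{j ≤ L} z_j κ(j) / j, with κ(j) the
number of divisors of d coprime to j. As z_j κ(j) has period lcm(d, g) in j, this tends to its
average ρ over a period (`tendsto_logAverage_rho`). The variance is O(1 / log L)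
(`tendsto_limitVariance`), and Chebyshev's inequality concentrates the limit at ρ. -/

namespace RandomWord

/-! ### Cycles of a self-map and minimal periods -/

section Cycles

open Function

variable {α : Type*} {f : α → α}

theorem eq_iterate_of_isChain {a : α} {s : List α}
    (h : List.IsChain (fun x y => f x = y) (a :: s)) :
    a :: s = List.iterate f a (s.length + 1) := by
  induction s generalizing a with
  | nil => simp
  | cons b s ih =>
    rw [List.isChain_cons_cons] at h
    obtain ⟨rfl, h⟩ := h
    rw [ih h]
    simp

/-- Rotate the cycle so that `x` comes first. The chain condition then lists the iterates of `x`,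
its closing link makes `x` periodic, and the absence of repetitions excludes a shorter period. -/
theorem minimalPeriod_and_periodicOrbit_of_chain {s : Cycle α} (hn : s.Nodup)
    (hc : s.Chain (fun x y => f x = y)) {x : α} (hx : x ∈ s) :
    minimalPeriod f x = s.length ∧ periodicOrbit f x = s := by
  obtain ⟨l, rfl⟩ : ∃ l : List α, s = (l : Cycle α) := ⟨_, (Quotient.out_eq s).symm⟩
  obtain ⟨t, ht⟩ : ∃ t, l ~r (x :: t) := by
    obtain ⟨n, hlt, rfl⟩ := List.getElem_of_mem (Cycle.mem_coe_iff.1 hx)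
    refine ⟨(l.rotate n).tail, n, ?_⟩
    have h0 : l.rotate n ≠ [] := by
      intro h
      simp [List.rotate_eq_nil_iff] at h
      simp [h] at hlt
    rw [← List.cons_head_tail h0]
    congr 1
    rw [List.head_eq_getElem, List.getElem_rotate]
    simp [Nat.mod_eq_of_lt hlt]
  rw [Cycle.coe_eq_coe.2 ht] at hn hc ⊢
  rw [Cycle.chain_coe_cons] at hc
  rw [Cycle.nodup_coe_iff] at hn
  have h1 := eq_iterate_of_isChain hc
  have h2 : (x :: t) = List.iterate f x (t.length + 1) := by
    have := congrArg (List.take (t.length + 1)) h1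
    rw [List.take_iterate] at this
    simpa using this
  have h3 : f^[t.length + 1] x = x := by
    have h := List.getElem_of_eq h1 (i := t.length + 1) (by simp)
    rw [List.getElem_iterate] at h
    simpa using h.symm
  have hp : minimalPeriod f x = t.length + 1 := by
    have hpos : 0 < minimalPeriod f x := IsPeriodicPt.minimalPeriod_pos (Nat.succ_pos _) h3
    refine le_antisymm (IsPeriodicPt.minimalPeriod_le (Nat.succ_pos _) h3) ?_
    by_contra! hlt
    rw [h2, ← List.range_map_iterate] at hn
    have := List.inj_on_of_nodup_map hn (x := 0) (y := minimalPeriod f x) (by simp)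
      (by simpa using hlt) (by simp)
    omega
  refine ⟨by simpa using hp, ?_⟩
  rw [periodicOrbit_def, hp, List.range_map_iterate, ← h2]

theorem mem_toFinset_cycle [DecidableEq α] (s : Cycle α) (x : α) : x ∈ s.toFinset ↔ x ∈ s :=
  Quotient.inductionOn' s fun l => by
    rw [Cycle.mk''_eq_coe, Cycle.coe_toFinset, List.mem_toFinset, Cycle.mem_coe_iff]

theorem card_toFinset_cycle [DecidableEq α] {s : Cycle α} (hs : s.Nodup) :
    s.toFinset.card = s.length := by
  obtain ⟨l, rfl⟩ : ∃ l : List α, s = (l : Cycle α) := ⟨_, (Quotient.out_eq s).symm⟩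
  rw [Cycle.coe_toFinset, Cycle.length_coe]
  exact List.toFinset_card_of_nodup (Cycle.nodup_coe_iff.1 hs)

/-- Sending a point to its orbit splits the points of minimal period `j` into blocks of size `j`, so
cycles up to rotation can be counted through points. -/
theorem card_minimalPeriod_eq [Fintype α] [DecidableEq α] (f : α → α) {j : ℕ} (hj : 0 < j) :
    (Finset.univ.filter fun x => minimalPeriod f x = j).card = j * cycleCount f j := by
  classical
  unfold cycleCount
  rw [Set.ncard_eq_toFinset_card _ (finite_cycles f j), mul_comm]
  rw [Finset.card_eq_sum_card_fiberwise (f := periodicOrbit f)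
    (t := (finite_cycles f j).toFinset)]
  · rw [Finset.sum_const_nat (m := j)]
    intro s hs
    rw [Set.Finite.mem_toFinset] at hs
    obtain ⟨hn, hl, hc⟩ := hs
    have : ((Finset.univ.filter fun x => minimalPeriod f x = j).filter
        fun x => periodicOrbit f x = s) = s.toFinset := by
      ext x
      simp only [Finset.mem_filter, Finset.mem_univ, true_and]
      constructor
      · rintro ⟨hx, rfl⟩
        have hx' : x ∈ periodicPts f := by
          rw [← minimalPeriod_pos_iff_mem_periodicPts]; omega
        exact (mem_toFinset_cycle _ _).2 (self_mem_periodicOrbit hx')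
      · intro hx
        obtain ⟨h1, h2⟩ := minimalPeriod_and_periodicOrbit_of_chain hn hc
          ((mem_toFinset_cycle _ _).1 hx)
        exact ⟨h1.trans hl, h2⟩
    rw [this, card_toFinset_cycle hn, hl]
  · intro x hx
    simp only [Finset.coe_filter, Finset.mem_univ, true_and, Set.mem_ofPred_eq] at hx
    have hx' : x ∈ periodicPts f := by
      rw [← minimalPeriod_pos_iff_mem_periodicPts]; omega
    simp only [Set.Finite.coe_toFinset, Set.mem_ofPred_eq]
    refine ⟨nodup_periodicOrbit, by rw [periodicOrbit_length, hx], ?_⟩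
    rw [periodicOrbit_chain' _ hx']
    intro n
    rw [iterate_succ_apply']

end Cycles

/-! ### Words -/

section Words

theorem wordPow_succ (u : List Letter) (m : ℕ) : wordPow u (m + 1) = wordPow u m ++ u := by
  simp [wordPow, List.replicate_succ']

theorem wordPow_mul (u : List Letter) (m d : ℕ) :
    wordPow (wordPow u m) d = wordPow u (m * d) := by
  induction d with
  | zero => simp [wordPow]
  | succ d ih =>
    rw [wordPow_succ, ih, Nat.mul_succ]
    simp only [wordPow, List.replicate_add, List.flatten_append]

theorem wordMap_append {α : Type*} (fa fb : α → α) (u v : List Letter) :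
    wordMap fa fb (u ++ v) = wordMap fa fb v ∘ wordMap fa fb u := by
  induction u with
  | nil => rfl
  | cons c u ih => simp only [List.cons_append, wordMap, ih, Function.comp_assoc]

theorem wordMap_wordPow {α : Type*} (fa fb : α → α) (u : List Letter) (m : ℕ) :
    wordMap fa fb (wordPow u m) = (wordMap fa fb u)^[m] := by
  induction m with
  | zero => rfl
  | succ m ih => rw [wordPow_succ, wordMap_append, ih, Function.iterate_succ']

/-- A non-empty word that is not a proper power. -/
def IsPrimitive (u : List Letter) : Prop :=
  u ≠ [] ∧ ∀ v m, u = wordPow v m → m ≤ 1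

theorem HasExponent.exists_primitive_root {w : List Letter} {d : ℕ} (h : HasExponent w d) :
    1 ≤ d ∧ ∃ u, IsPrimitive u ∧ w = wordPow u d := by
  obtain ⟨⟨hd, u, rfl⟩, hmax⟩ := h
  refine ⟨hd, u, ⟨?_, ?_⟩, rfl⟩
  · rintro rfl
    have := hmax (a := d + 1) ⟨by omega, [], by simp [wordPow]⟩
    omega
  · rintro v m rfl
    by_contra! hm
    have := hmax (a := m * d) ⟨Nat.mul_pos (by omega) hd, v, wordPow_mul v m d⟩
    nlinarith

/-- The letters of the periodic infinite word `u u u ⋯`. -/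
def cyclicLetter (u : List Letter) (t : ℕ) : Letter :=
  u.getD (t % u.length) Letter.a

theorem cyclicLetter_add_mul (u : List Letter) (t m : ℕ) :
    cyclicLetter u (t + m * u.length) = cyclicLetter u t := by
  simp [cyclicLetter]

theorem cyclicLetter_mod_mul (u : List Letter) (t m : ℕ) :
    cyclicLetter u (t % (m * u.length)) = cyclicLetter u t := by
  simp [cyclicLetter, Nat.mod_mod_of_dvd]

theorem map_range_cyclicLetter (u : List Letter) :
    (List.range u.length).map (cyclicLetter u) = u := by
  refine List.ext_getElem (by simp) fun i h1 h2 => ?_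
  simp [cyclicLetter, Nat.mod_eq_of_lt h2, h2]

theorem map_range_mul_of_periodic {F : ℕ → Letter} {e : ℕ} (hF : ∀ b, F (b + e) = F b) (m : ℕ) :
    (List.range (e * m)).map F = wordPow ((List.range e).map F) m := by
  induction m with
  | zero => simp [wordPow]
  | succ m ih =>
    have h (m b : ℕ) : F (e * m + b) = F b := by
      induction m with
      | zero => simp
      | succ m ih => rw [← ih, ← hF (e * m + b)]; congr 1; ring
    rw [wordPow_succ, ← ih, Nat.mul_succ, List.range_add, List.map_append, List.map_map]
    simp [Function.comp_def, h]

/-- The periodic word also has period `u.length`, hence by Bézout the period gcd(δ, |u|). So `u` is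
a power of its prefix of that length, and primitivity makes the prefix all of `u`. -/
theorem IsPrimitive.length_dvd_of_shift {u : List Letter} (hu : IsPrimitive u) {δ : ℕ}
    (h : ∀ b, cyclicLetter u (b + δ) = cyclicLetter u b) : u.length ∣ δ := by
  by_contra hk
  have hpos : 0 < u.length := List.length_pos_iff.2 hu.1
  have he : Nat.gcd δ u.length < u.length :=
    lt_of_le_of_ne (Nat.le_of_dvd hpos (Nat.gcd_dvd_right _ _)) fun h => hk
      (h ▸ Nat.gcd_dvd_left _ _)
  obtain ⟨m, -, hm⟩ := Nat.exists_mul_mod_eq_gcd he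
  have hmul (j b : ℕ) : cyclicLetter u (b + δ * j) = cyclicLetter u b := by
    induction j with
    | zero => simp
    | succ j ih => rw [Nat.mul_succ, ← add_assoc, h, ih]
  have hgcd (b : ℕ) : cyclicLetter u (b + Nat.gcd δ u.length) = cyclicLetter u b := by
    rw [← hmul m b, ← cyclicLetter_add_mul u _ (δ * m / u.length), ← hm]
    congr 1
    have := Nat.mod_add_div' (δ * m) u.length
    omega
  obtain ⟨q, hq⟩ := Nat.gcd_dvd_right δ u.length
  have h1 := map_range_mul_of_periodic hgcd q
  rw [← hq, map_range_cyclicLetter] at h1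
  have h2 := hu.2 _ _ h1
  have : Nat.gcd δ u.length * q ≤ Nat.gcd δ u.length * 1 := Nat.mul_le_mul_left _ h2
  omega

theorem IsPrimitive.modEq_of_shift {u : List Letter} (hu : IsPrimitive u) {s t : ℕ}
    (h : ∀ a, cyclicLetter u (s + a) = cyclicLetter u (t + a)) : s ≡ t [MOD u.length] := by
  wlog hst : s ≤ t generalizing s t
  · exact (this (fun a => (h a).symm) (by omega)).symm
  have hpos : 0 < u.length := List.length_pos_iff.2 hu.1
  rw [Nat.modEq_iff_dvd' hst]
  refine hu.length_dvd_of_shift fun b => ?_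
  -- The hypothesis only concerns letters from `s` onwards; adding `s` full periods moves every `b`
  -- into that range.
  rw [← cyclicLetter_add_mul u b s, ← cyclicLetter_add_mul u _ s]
  have hs : s ≤ s * u.length := Nat.le_mul_of_pos_right _ hpos
  have := h (b + s * u.length - s)
  rw [show s + (b + s * u.length - s) = b + s * u.length by omega,
    show t + (b + s * u.length - s) = b + (t - s) + s * u.length by omega] at this
  exact this.symm

end Words

/-! ### Trajectories -/

section Trajectories

variable {α : Type*} (fa fb : α → α)

/-- The successive images of `x` under the functions attached to the letters of `u u u ⋯`. -/
def trajectory (u : List Letter) (x : α) : ℕ → α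
  | 0 => x
  | t + 1 => letterMap fa fb (cyclicLetter u t) (trajectory u x t)

theorem trajectory_length (u : List Letter) (x : α) :
    trajectory fa fb u x u.length = wordMap fa fb u x := by
  have h (t : ℕ) : wordMap fa fb ((List.range t).map (cyclicLetter u)) x
      = trajectory fa fb u x t := by
    induction t with
    | zero => rfl
    | succ t ih =>
      rw [List.range_succ, List.map_append, wordMap_append, Function.comp_apply, ih]
      rfl
  rw [← h, map_range_cyclicLetter]

theorem trajectory_length_add (u : List Letter) (x : α) (t : ℕ) :
    trajectory fa fb u x (t + u.length) = trajectory fa fb u (wordMap fa fb u x) t := by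
  induction t with
  | zero => simpa [trajectory] using trajectory_length fa fb u x
  | succ t ih =>
    rw [Nat.add_right_comm, trajectory, trajectory, ih]
    congr 1
    simpa using cyclicLetter_add_mul u t 1

theorem trajectory_add_mul (u : List Letter) (x : α) (t m : ℕ) :
    trajectory fa fb u x (t + m * u.length)
      = trajectory fa fb u ((wordMap fa fb u)^[m] x) t := by
  induction m generalizing x with
  | zero => simp
  | succ m ih =>
    rw [Nat.succ_mul, ← add_assoc, trajectory_length_add, ih, Function.iterate_succ_apply]

theorem trajectory_mul (u : List Letter) (x : α) (m : ℕ) :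
    trajectory fa fb u x (m * u.length) = (wordMap fa fb u)^[m] x := by
  simpa [trajectory] using trajectory_add_mul fa fb u x 0 m

end Trajectories

/-! ### Tuples of points on distinct cycles -/

section Tuples

open Function

/-- `x` is a tuple of periodic points with prescribed minimal periods on different cycles. -/
def IsCycleTuple {α : Type*} (f : α → α) {r : ℕ} (ℓ : Fin r → ℕ) (x : Fin r → α) : Prop :=
  (∀ i, minimalPeriod f (x i) = ℓ i) ∧ ∀ i j, i ≠ j → ∀ a, f^[a] (x i) ≠ x j

theorem iterate_ne_symm {α : Type*} {f : α → α} {x y : α} (hy : 0 < minimalPeriod f y)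
    (h : ∀ a, f^[a] x ≠ y) (a : ℕ) : f^[a] y ≠ x := by
  intro hyx
  -- After the `a` steps from `y` to `x`, this many more complete `a` turns of the cycle of `y`.
  apply h (minimalPeriod f y * a - a)
  rw [← hyx, ← iterate_add_apply, Nat.sub_add_cancel (Nat.le_mul_of_pos_left _ hy)]
  exact (isPeriodicPt_minimalPeriod f y).mul_const a

theorem isCycleTuple_succ {α : Type*} {f : α → α} {r : ℕ} {ℓ : Fin (r + 1) → ℕ}
    (hℓ : ∀ i, 0 < ℓ i) (x : Fin (r + 1) → α) :
    IsCycleTuple f ℓ x ↔ IsCycleTuple f (Fin.tail ℓ) (Fin.tail x) ∧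
      minimalPeriod f (x 0) = ℓ 0 ∧ ∀ i a, f^[a] (Fin.tail x i) ≠ x 0 := by
  simp only [IsCycleTuple, Fin.tail]
  constructor
  · rintro ⟨h1, h2⟩
    exact ⟨⟨fun i => h1 _, fun i j hij => h2 _ _ (by simpa using hij)⟩, h1 0,
      fun i => h2 _ _ (Fin.succ_ne_zero _)⟩
  · rintro ⟨⟨h1, h2⟩, h3, h4⟩
    refine ⟨Fin.cases h3 h1, ?_⟩
    refine Fin.cases (Fin.cases (fun h => absurd rfl h) fun j _ => ?_)
      fun i => Fin.cases (fun _ => h4 i) fun j hij => h2 i j (by simpa using hij)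
    exact iterate_ne_symm (h3 ▸ hℓ 0) (h4 j)

theorem prod_descFactorial_update {ι : Type*} [DecidableEq ι] (S : Finset ι) (V c c' : ι → ℕ)
    {i : ι} (hi : i ∈ S) (h1 : c' i = c i + 1) (h2 : ∀ j, j ≠ i → c' j = c j) :
    ∏ j ∈ S, (V j).descFactorial (c' j) = (V i - c i) * ∏ j ∈ S, (V j).descFactorial (c j) := by
  rw [← Finset.mul_prod_erase S _ hi, ← Finset.mul_prod_erase S _ hi, h1,
    Nat.descFactorial_succ, mul_assoc]
  congr 2
  refine Finset.prod_congr rfl fun j hj => ?_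
  rw [h2 j (Finset.ne_of_mem_erase hj)]

variable {α : Type*} [Fintype α]

open Classical in
-- Only the orbits of the `x i` with `ℓ i = m` contain points of minimal period `m`. They are
-- pairwise disjoint, and each removes `m` points.
theorem card_minimalPeriod_notMem_orbits (f : α → α) {m : ℕ} (hm : 0 < m) {r : ℕ}
    {ℓ : Fin r → ℕ} (hℓ : ∀ i, 0 < ℓ i) {x : Fin r → α} (hx : IsCycleTuple f ℓ x) :
    (Finset.univ.filter fun x₀ => minimalPeriod f x₀ = m ∧ ∀ i a, f^[a] (x i) ≠ x₀).card
      = m * (cycleCount f m - (Finset.univ.filter fun i => ℓ i = m).card) := by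
  have hper (i) : x i ∈ periodicPts f := by
    rw [← minimalPeriod_pos_iff_mem_periodicPts, hx.1 i]; exact hℓ i
  have hunion : (Finset.univ.filter fun x₀ =>
      minimalPeriod f x₀ = m ∧ ∀ i a, f^[a] (x i) ≠ x₀)
      = (Finset.univ.filter fun x₀ => minimalPeriod f x₀ = m) \
        (Finset.univ.filter fun i => ℓ i = m).biUnion
          fun i => (Finset.range m).image fun a => f^[a] (x i) := by
    ext y
    simp only [Finset.mem_filter, Finset.mem_univ, true_and, Finset.mem_sdiff,
      Finset.mem_biUnion, Finset.mem_image, Finset.mem_range, not_exists, not_and]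
    refine and_congr_right fun hy => ⟨fun h i _ a _ => h i a, fun h i a ha => ?_⟩
    have hi : ℓ i = m := by rw [← hy, ← ha, minimalPeriod_apply_iterate (hper i), hx.1 i]
    refine h i hi (a % m) (Nat.mod_lt _ hm) ?_
    rw [← ha, ← hi, ← hx.1 i, iterate_mod_minimalPeriod_eq]
  rw [hunion, Finset.card_sdiff_of_subset, card_minimalPeriod_eq f hm, Finset.card_biUnion,
    Finset.sum_const_nat (m := m), Nat.mul_sub, mul_comm m (Finset.card _)]
  · intro i hi
    simp only [Finset.mem_filter, Finset.mem_univ, true_and] at hi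
    rw [Finset.card_image_of_injOn, Finset.card_range]
    intro a ha b hb hab
    simp only [Finset.coe_range, Set.mem_Iio] at ha hb
    refine iterate_injOn_Iio_minimalPeriod (f := f) (x := x i) ?_ ?_ hab
    · simpa [hx.1 i, hi] using ha
    · simpa [hx.1 i, hi] using hb
  · intro i _ j _ hij
    rw [Function.onFun, Finset.disjoint_left]
    intro y hy hy'
    simp only [Finset.mem_image, Finset.mem_range] at hy hy'
    obtain ⟨a, -, rfl⟩ := hy
    obtain ⟨b, -, hb⟩ := hy'
    refine hx.2 i j hij (minimalPeriod f (x j) * b - b + a) ?_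
    have hj : 0 < minimalPeriod f (x j) := hx.1 j ▸ hℓ j
    rw [iterate_add_apply, ← hb, ← iterate_add_apply,
      Nat.sub_add_cancel (Nat.le_mul_of_pos_left _ hj)]
    exact (isPeriodicPt_minimalPeriod f _).mul_const b
  · intro y hy
    simp only [Finset.mem_biUnion, Finset.mem_filter, Finset.mem_univ, true_and,
      Finset.mem_image, Finset.mem_range] at hy ⊢
    obtain ⟨i, hi, a, -, rfl⟩ := hy
    rw [minimalPeriod_apply_iterate (hper i), hx.1 i, hi]

open Classical in
-- Once the tail of the tuple is fixed, its first point may lie anywhere on an unused cycle of the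
-- right length. The falling factorials record the choices of cycles, the product of the `ℓ i` the
-- choices of points on them.
theorem card_isCycleTuple (f : α → α) {r : ℕ} (ℓ : Fin r → ℕ) (hℓ : ∀ i, 0 < ℓ i)
    (S : Finset ℕ) (hS : ∀ i, ℓ i ∈ S) :
    (Finset.univ.filter (IsCycleTuple f ℓ)).card
      = (∏ i, ℓ i) * ∏ m ∈ S,
        (cycleCount f m).descFactorial (Finset.univ.filter fun i => ℓ i = m).card := by
  induction r with
  | zero =>
    have : IsCycleTuple f ℓ = fun _ => True := by
      ext x
      simp [IsCycleTuple]
    simp [this]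
  | succ r ih =>
    have ih' := ih (Fin.tail ℓ) (fun i => hℓ _) (fun i => hS _)
    rw [Finset.card_eq_sum_card_fiberwise (f := Fin.tail (α := fun _ => α))
      (t := Finset.univ.filter (IsCycleTuple f (Fin.tail ℓ))),
      Finset.sum_const_nat (m := ℓ 0 * (cycleCount f (ℓ 0)
        - (Finset.univ.filter fun i => Fin.tail ℓ i = ℓ 0).card)), ih', Fin.prod_univ_succ,
      prod_descFactorial_update S (cycleCount f)
        (fun m => (Finset.univ.filter fun i => Fin.tail ℓ i = m).card)
        (fun m => (Finset.univ.filter fun i => ℓ i = m).card) (hS 0)]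
    · simp only [Fin.tail]
      ring
    · simp [Fin.card_filter_univ_succ, Fin.tail]
      rfl
    · intro j hj
      simp [Fin.card_filter_univ_succ, Fin.tail, hj.symm]
      rfl
    · intro y hy
      simp only [Finset.mem_filter, Finset.mem_univ, true_and] at hy
      refine Eq.trans ?_ (card_minimalPeriod_notMem_orbits f (hℓ 0) (fun i => hℓ i.succ) hy)
      refine Finset.card_bij' (fun x _ => x 0) (fun x₀ _ => Fin.cons x₀ y) ?_ ?_ ?_ ?_
      · intro x hx
        simp only [Finset.mem_filter, Finset.mem_univ, true_and] at hx ⊢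
        rw [isCycleTuple_succ hℓ] at hx
        obtain ⟨⟨-, h2⟩, rfl⟩ := hx
        exact h2
      · intro x₀ hx₀
        simp only [Finset.mem_filter, Finset.mem_univ, true_and] at hx₀ ⊢
        rw [isCycleTuple_succ hℓ, Fin.tail_cons, Fin.cons_zero]
        exact ⟨⟨hy, hx₀⟩, rfl⟩
      · intro x hx
        simp only [Finset.mem_filter, Finset.mem_univ, true_and] at hx
        rw [← hx.2, Fin.cons_self_tail]
      · intro x₀ _
        rfl
    · intro x hx
      simp only [Finset.coe_filter, Finset.mem_univ, true_and, Set.mem_ofPred_eq] at hx ⊢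
      exact ((isCycleTuple_succ hℓ x).1 hx).1

end Tuples
/-! ### Counting closed trajectories of a pair of functions -/

section ClosedTrajectories

open Classical in
theorem card_filter_eqOn_finset {β : Type*} [Fintype β] [DecidableEq β] (f₀ : β → β) (E : Finset β) :
    (Finset.univ.filter fun f : β → β => ∀ x ∈ E, f x = f₀ x).card
      * Fintype.card β ^ E.card = Fintype.card β ^ Fintype.card β := by
  have : (Finset.univ.filter fun f : β → β => ∀ x ∈ E, f x = f₀ x)
      = Fintype.piFinset fun x => if x ∈ E then {f₀ x} else Finset.univ := by
    ext f
    simp only [Finset.mem_filter, Finset.mem_univ, true_and, Fintype.mem_piFinset]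
    refine forall_congr' fun x => ?_
    by_cases hx : x ∈ E <;> simp [hx]
  rw [this, Fintype.card_piFinset]
  simp only [apply_ite Finset.card, Finset.card_singleton, Finset.card_univ]
  rw [Finset.prod_ite, Finset.prod_const_one, one_mul, Finset.prod_const, ← pow_add]
  congr 1
  have h : (Finset.univ.filter fun x => x ∈ E) = E := by ext; simp
  rw [add_comm]
  nth_rw 1 [← h]
  exact Finset.card_filter_add_card_filter_not _

open Classical in
-- Each distinct constrained point costs a factor `Fintype.card β`. For a non-injective `p` the
-- constraints may contradict each other, which leaves only an inequality.
theorem card_filter_interpolation {β Q : Type*} [Fintype β] [DecidableEq β] (A : Finset Q) (p y : Q → β) :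
    ((Finset.univ.filter fun f : β → β => ∀ q ∈ A, f (p q) = y q).card
      * Fintype.card β ^ (A.image p).card ≤ Fintype.card β ^ Fintype.card β) ∧
    (p.Injective → (Finset.univ.filter fun f : β → β => ∀ q ∈ A, f (p q) = y q).card
      * Fintype.card β ^ A.card = Fintype.card β ^ Fintype.card β) := by
  have key (f₀ : β → β) (h₀ : ∀ q ∈ A, f₀ (p q) = y q) :
      (Finset.univ.filter fun f : β → β => ∀ q ∈ A, f (p q) = y q).card
      * Fintype.card β ^ (A.image p).card = Fintype.card β ^ Fintype.card β := by
    rw [← card_filter_eqOn_finset f₀ (A.image p)]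
    congr 3
    ext f
    simp only [Finset.forall_mem_image]
    exact forall₂_congr fun q hq => by rw [h₀ q hq]
  constructor
  · by_cases h : ∃ f₀ : β → β, ∀ q ∈ A, f₀ (p q) = y q
    · exact (key h.choose h.choose_spec).le
    · rw [Finset.filter_false_of_mem fun f _ hf => h ⟨f, hf⟩]
      simp
  · intro hp
    rw [← Finset.card_image_of_injective A hp]
    refine key (fun b => if h : ∃ q, p q = b then y h.choose else b) fun q _ => ?_
    have h : ∃ q', p q' = p q := ⟨q, rfl⟩
    rw [dif_pos h, hp h.choose_spec]

variable {β Q : Type*}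

/-- The labelled transitions `q ⟶ next q` are realised by the pair of functions `ω` at the
points `p q`. -/
def IsClosedTrajectory (letter : Q → Letter) (next : Q → Q) (ω : (β → β) × (β → β))
    (p : Q → β) : Prop :=
  ∀ q, letterMap ω.1 ω.2 (letter q) (p q) = p (next q)

variable [Fintype Q] [DecidableEq β]

open Classical in
/-- The number of different (point, letter) pairs along `p`. -/
noncomputable def edgeCard (letter : Q → Letter) (p : Q → β) : ℕ :=
  ((Finset.univ.filter fun q => letter q = Letter.a).image p).card
    + ((Finset.univ.filter fun q => letter q = Letter.b).image p).card

/-- The number of different points along `p`. -/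
noncomputable def vertexCard (p : Q → β) : ℕ := (Finset.univ.image p).card

/-- The points are the union of those left by `a` and those left by `b`. If the two sizes add up to
at most the size of the union, the two sets are disjoint. -/
theorem letter_eq_of_edgeCard_le {letter : Q → Letter} {p : Q → β}
    (h : edgeCard letter p ≤ vertexCard p) {q q' : Q} (hq : p q = p q') :
    letter q = letter q' := by
  classical
  have hunion : (Finset.univ.image p)
      = (Finset.univ.filter fun q => letter q = Letter.a).image p
        ∪ (Finset.univ.filter fun q => letter q = Letter.b).image p := by
    rw [← Finset.image_union, ← Finset.filter_or]
    congr 1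
    refine (Finset.filter_true_of_mem fun q _ => ?_).symm
    cases letter q <;> simp
  have hdisj : Disjoint ((Finset.univ.filter fun q => letter q = Letter.a).image p)
      ((Finset.univ.filter fun q => letter q = Letter.b).image p) := by
    rw [Finset.disjoint_iff_inter_eq_empty, ← Finset.card_eq_zero]
    have := Finset.card_union_add_card_inter
      ((Finset.univ.filter fun q => letter q = Letter.a).image p)
      ((Finset.univ.filter fun q => letter q = Letter.b).image p)
    rw [← hunion] at this
    unfold edgeCard vertexCard at h
    omega
  have hne {q q' : Q} (h1 : letter q = Letter.a) (h2 : letter q' = Letter.b) : p q ≠ p q' := by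
    intro h
    have h3 : p q ∈ (Finset.univ.filter fun q => letter q = Letter.a).image p :=
      Finset.mem_image_of_mem _ (by simpa using h1)
    refine Finset.disjoint_left.1 hdisj h3 ?_
    rw [h]
    exact Finset.mem_image_of_mem _ (by simpa using h2)
  cases h1 : letter q <;> cases h2 : letter q'
  · rfl
  · exact (hne h1 h2 hq).elim
  · exact (hne h2 h1 hq.symm).elim
  · rfl

variable [Fintype β] [DecidableEq Q]

theorem card_filter_vertexCard_le (v : ℕ) :
    (Finset.univ.filter fun p : Q → β => vertexCard p = v).card
      ≤ Fintype.card β ^ v * v ^ Fintype.card Q := by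
  classical
  have : (Finset.univ.filter fun p : Q → β => vertexCard p = v)
      ⊆ (Finset.univ : Finset ((Fin v → β) × (Q → Fin v))).image fun fg => fg.1 ∘ fg.2 := by
    intro p hp
    simp only [Finset.mem_filter, Finset.mem_univ, true_and, Finset.mem_image] at hp ⊢
    rw [vertexCard] at hp
    have e := (Finset.univ.image p).equivFinOfCardEq hp
    refine ⟨(fun i => (e.symm i : β), fun q => e ⟨p q, Finset.mem_image_of_mem p
      (Finset.mem_univ q)⟩), ?_⟩
    ext q
    simp
  refine (Finset.card_le_card this).trans (Finset.card_image_le.trans ?_)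
  simp

open Classical in
theorem card_isClosedTrajectory (letter : Q → Letter) (next : Q → Q) (p : Q → β) :
    ((Finset.univ.filter fun ω => IsClosedTrajectory letter next ω p).card
      * Fintype.card β ^ edgeCard letter p ≤ Fintype.card ((β → β) × (β → β))) ∧
    (p.Injective → (Finset.univ.filter fun ω => IsClosedTrajectory letter next ω p).card
      * Fintype.card β ^ Fintype.card Q = Fintype.card ((β → β) × (β → β))) := by
  have hprod : (Finset.univ.filter fun ω => IsClosedTrajectory letter next ω p)
      = (Finset.univ.filter fun f : β → β =>
          ∀ q ∈ Finset.univ.filter (fun q => letter q = Letter.a), f (p q) = p (next q)) ×ˢ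
        (Finset.univ.filter fun f : β → β =>
          ∀ q ∈ Finset.univ.filter (fun q => letter q = Letter.b), f (p q) = p (next q)) := by
    ext ω
    rw [Finset.mem_product, Finset.mem_filter, Finset.mem_filter, Finset.mem_filter]
    simp only [IsClosedTrajectory, Finset.mem_filter, Finset.mem_univ, true_and, ← forall_and]
    refine forall_congr' fun q => ?_
    cases letter q <;> simp [letterMap]
  have hQ : (Finset.univ.filter fun q => letter q = Letter.a).card
      + (Finset.univ.filter fun q => letter q = Letter.b).card = Fintype.card Q := by
    rw [← Finset.card_union_of_disjoint, ← Finset.filter_or, Finset.filter_true_of_mem,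
      Finset.card_univ]
    · intro q _
      cases letter q <;> simp
    · rw [Finset.disjoint_filter]
      intro q _ h
      simp [h]
  have ha := card_filter_interpolation (Finset.univ.filter fun q => letter q = Letter.a) p
    (fun q => p (next q))
  have hb := card_filter_interpolation (Finset.univ.filter fun q => letter q = Letter.b) p
    (fun q => p (next q))
  rw [hprod, Finset.card_product, Fintype.card_prod, Fintype.card_fun]
  constructor
  · rw [edgeCard, pow_add, mul_mul_mul_comm]
    exact Nat.mul_le_mul (by convert ha.1) (by convert hb.1)
  · intro hp
    rw [← hQ, pow_add, mul_mul_mul_comm]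
    exact congrArg₂ (· * ·) (by convert ha.2 hp) (by convert hb.2 hp)

open Classical in
theorem sum_card_injective_isClosedTrajectory (letter : Q → Letter) (next : Q → Q) :
    (∑ ω : (β → β) × (β → β),
      (Finset.univ.filter fun p => IsClosedTrajectory letter next ω p ∧ p.Injective).card)
      * Fintype.card β ^ Fintype.card Q
      = (Fintype.card β).descFactorial (Fintype.card Q)
        * Fintype.card ((β → β) × (β → β)) := by
  have h1 : (Finset.univ.filter fun p : Q → β => p.Injective).card
      = (Fintype.card β).descFactorial (Fintype.card Q) := by
    rw [← Fintype.card_embedding_eq, ← Fintype.card_subtype]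
    exact Fintype.card_congr (Equiv.subtypeInjectiveEquivEmbedding Q β)
  simp only [Finset.card_filter]
  rw [Finset.sum_comm, Finset.sum_mul, ← h1, Finset.card_filter, Finset.sum_mul]
  refine Finset.sum_congr rfl fun p _ => ?_
  by_cases hp : p.Injective
  · simp only [hp, and_true, if_true, one_mul]
    rw [← Finset.card_filter]
    exact (card_isClosedTrajectory letter next p).2 hp
  · simp [hp]

open Classical in
-- This is the error term. A walk with v points has at least v + 1 edges here, so it is realised by
-- a proportion at most n^(-v-1) of the pairs, and there are at most n^v v^|Q| such walks.
theorem sum_card_vertexCard_lt_edgeCard_le [Nonempty β] (letter : Q → Letter) (next : Q → Q) :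
    ((∑ ω : (β → β) × (β → β), (Finset.univ.filter fun p =>
      IsClosedTrajectory letter next ω p ∧ vertexCard p < edgeCard letter p).card : ℕ) : ℝ)
      ≤ Fintype.card ((β → β) × (β → β)) / Fintype.card β
        * ∑ v ∈ Finset.range (Fintype.card Q + 1), (v : ℝ) ^ Fintype.card Q := by
  have hβ : (1 : ℝ) ≤ Fintype.card β := by exact_mod_cast Fintype.card_pos
  have hβ0 : (0 : ℝ) < Fintype.card β := by linarith
  have hle (p : Q → β) : ((∑ ω : (β → β) × (β → β), if IsClosedTrajectory letter next ω p ∧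
      vertexCard p < edgeCard letter p then 1 else 0 : ℕ) : ℝ)
      ≤ Fintype.card ((β → β) × (β → β)) / Fintype.card β
        * (1 / (Fintype.card β : ℝ) ^ vertexCard p) := by
    by_cases hp : vertexCard p < edgeCard letter p
    · simp only [hp, and_true]
      rw [← Finset.card_filter, div_mul_div_comm, mul_one, ← pow_succ',
        le_div_iff₀ (by positivity)]
      have := (card_isClosedTrajectory letter next p).1
      refine le_trans ?_ (Nat.cast_le.2 this)
      push_cast
      gcongr
      exact hp
    · simp only [hp, and_false, if_false, Finset.sum_const_zero, Nat.cast_zero]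
      positivity
  simp only [Finset.card_filter]
  rw [Finset.sum_comm, Nat.cast_sum]
  refine (Finset.sum_le_sum fun p _ => hle p).trans ?_
  rw [← Finset.mul_sum]
  refine mul_le_mul_of_nonneg_left ?_ (by positivity)
  rw [← Finset.sum_fiberwise_of_maps_to (g := vertexCard)
    (t := Finset.range (Fintype.card Q + 1))]
  · refine Finset.sum_le_sum fun v _ => ?_
    rw [Finset.sum_congr rfl (g := fun _ => 1 / (Fintype.card β : ℝ) ^ v)
      fun p hp => by rw [(Finset.mem_filter.1 hp).2], Finset.sum_const, nsmul_eq_mul,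
      mul_one_div, div_le_iff₀ (by positivity), mul_comm (_ ^ _)]
    exact_mod_cast card_filter_vertexCard_le v
  · intro p _
    rw [Finset.mem_range, Nat.lt_succ_iff]
    exact Finset.card_image_le

end ClosedTrajectories
/-! ### Factorial moments of the cycle counts of a primitive word -/

section Moments

open Function

/-- The times at which the trajectories of a cycle tuple are followed, over `ℓ i` periods of a
word of length `k`. -/
abbrev Position {r : ℕ} (ℓ : Fin r → ℕ) (k : ℕ) : Type := Σ i : Fin r, Fin (ℓ i * k)

/-- The letter read at a position. -/
def positionLetter (u : List Letter) {r : ℕ} {ℓ : Fin r → ℕ} (q : Position ℓ u.length) : Letter :=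
  cyclicLetter u q.2

/-- The cyclically next position. -/
def positionNext {r : ℕ} {ℓ : Fin r → ℕ} {k : ℕ} (q : Position ℓ k) : Position ℓ k :=
  ⟨q.1, ⟨(q.2 + 1) % (ℓ q.1 * k), Nat.mod_lt _ (Nat.zero_lt_of_lt q.2.2)⟩⟩

variable {α : Type*} {u : List Letter} {r : ℕ} {ℓ : Fin r → ℕ}

/-- The trajectories of the points of a tuple. -/
def tupleTrajectory (ω : (α → α) × (α → α)) (u : List Letter) (ℓ : Fin r → ℕ) (x : Fin r → α)
    (q : Position ℓ u.length) : α :=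
  trajectory ω.1 ω.2 u (x q.1) q.2

theorem isClosedTrajectory_tupleTrajectory {ω : (α → α) × (α → α)} {x : Fin r → α}
    (hx : ∀ i, (wordMap ω.1 ω.2 u)^[ℓ i] (x i) = x i) :
    IsClosedTrajectory (positionLetter u) positionNext ω (tupleTrajectory ω u ℓ x) := by
  rintro ⟨i, t⟩
  change trajectory ω.1 ω.2 u (x i) (t + 1)
    = trajectory ω.1 ω.2 u (x i) ((t + 1) % (ℓ i * u.length))
  rcases (Nat.succ_le_of_lt t.2).lt_or_eq with h | h
  · rw [Nat.mod_eq_of_lt h]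
  · rw [Nat.succ_eq_add_one] at h
    rw [h, Nat.mod_self, trajectory_mul, hx]
    rfl

/-- A closed trajectory is determined by its values at time 0. Time 0 is written `0 % _` to match
the left-hand side at `s = 0`. -/
theorem IsClosedTrajectory.apply_mod
    {ω : (α → α) × (α → α)} {p : Position ℓ u.length → α}
    (hp : IsClosedTrajectory (positionLetter u) positionNext ω p) (i : Fin r)
    (h0 : ∀ s, s % (ℓ i * u.length) < ℓ i * u.length) (s : ℕ) :
    p ⟨i, ⟨s % (ℓ i * u.length), h0 s⟩⟩
      = trajectory ω.1 ω.2 u (p ⟨i, ⟨0 % (ℓ i * u.length), h0 0⟩⟩) s := by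
  induction s with
  | zero => rfl
  | succ s ih =>
    rw [trajectory, ← ih, ← cyclicLetter_mod_mul u s (ℓ i)]
    refine Eq.trans ?_ (hp ⟨i, ⟨s % (ℓ i * u.length), h0 s⟩⟩).symm
    simp [positionNext, Nat.mod_add_mod]

theorem IsClosedTrajectory.isCycleTuple (hu : u ≠ []) (hℓ : ∀ i, 0 < ℓ i)
    {ω : (α → α) × (α → α)} {p : Position ℓ u.length → α}
    (hp : IsClosedTrajectory (positionLetter u) positionNext ω p) (hinj : p.Injective)
    (h0 : ∀ i s, s % (ℓ i * u.length) < ℓ i * u.length) :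
    IsCycleTuple (wordMap ω.1 ω.2 u) ℓ fun i => p ⟨i, ⟨0 % (ℓ i * u.length), h0 i 0⟩⟩ := by
  have hk : 0 < u.length := List.length_pos_iff.2 hu
  have hiter (i) (a : ℕ) : (wordMap ω.1 ω.2 u)^[a] (p ⟨i, ⟨0 % (ℓ i * u.length), h0 i 0⟩⟩)
      = p ⟨i, ⟨(a * u.length) % (ℓ i * u.length), h0 i _⟩⟩ := by
    rw [hp.apply_mod i (h0 i) (a * u.length), trajectory_mul]
  have hper (i) : IsPeriodicPt (wordMap ω.1 ω.2 u) (ℓ i)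
      (p ⟨i, ⟨0 % (ℓ i * u.length), h0 i 0⟩⟩) := by
    rw [IsPeriodicPt, IsFixedPt, hiter]
    simp
  refine ⟨fun i => ?_, fun i j hij a h => ?_⟩
  · refine le_antisymm ((hper i).minimalPeriod_le (hℓ i)) ?_
    by_contra! hlt
    have hpos := (hper i).minimalPeriod_pos (hℓ i)
    generalize hm : minimalPeriod (wordMap ω.1 ω.2 u)
      (p ⟨i, ⟨0 % (ℓ i * u.length), h0 i 0⟩⟩) = m at hlt hpos
    have h : p ⟨i, ⟨0 % (ℓ i * u.length), h0 i 0⟩⟩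
        = p ⟨i, ⟨(m * u.length) % (ℓ i * u.length), h0 i _⟩⟩ := by
      rw [← hiter i m, ← hm]
      exact iterate_minimalPeriod.symm
    have h2 := hinj h
    simp only [Nat.zero_mod, Sigma.mk.injEq, heq_eq_eq, Fin.mk.injEq, true_and] at h2
    rw [Nat.mod_eq_of_lt (Nat.mul_lt_mul_of_pos_right hlt hk)] at h2
    exact (Nat.mul_pos hpos hk).ne h2
  · rw [hiter] at h
    exact hij (congrArg Sigma.fst (hinj h))

/-- This is where primitivity enters. Each point is left by a single letter, so two trajectories
that meet read the same letters from then on and their phases agree modulo `u.length`. When both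
next start a copy of `u` together, two orbits of the transition of `u` meet; a cycle tuple allows
this only for equal indices, at times congruent modulo the period. -/
theorem IsPrimitive.tupleTrajectory_injective [DecidableEq α] (hu : IsPrimitive u) (hℓ : ∀ i, 0 < ℓ i)
    {ω : (α → α) × (α → α)} {x : Fin r → α} (hx : IsCycleTuple (wordMap ω.1 ω.2 u) ℓ x)
    (he : edgeCard (positionLetter u) (tupleTrajectory ω u ℓ x)
      ≤ vertexCard (tupleTrajectory ω u ℓ x)) :
    (tupleTrajectory ω u ℓ x).Injective := by
  have hk : 0 < u.length := List.length_pos_iff.2 hu.1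
  have hper (i) : (wordMap ω.1 ω.2 u)^[ℓ i] (x i) = x i := by
    rw [← hx.1 i]; exact iterate_minimalPeriod
  have hmod (i s) : trajectory ω.1 ω.2 u (x i) s
      = trajectory ω.1 ω.2 u (x i) (s % (ℓ i * u.length)) := by
    conv_lhs => rw [← Nat.mod_add_div' s (ℓ i * u.length), ← mul_assoc, trajectory_add_mul]
    congr 1
    rw [mul_comm]
    exact IsPeriodicPt.mul_const (hper i) _
  have hletter (i j s t) (h : trajectory ω.1 ω.2 u (x i) s = trajectory ω.1 ω.2 u (x j) t) :
      cyclicLetter u s = cyclicLetter u t := by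
    rw [hmod i, hmod j] at h
    have := letter_eq_of_edgeCard_le he
      (q := ⟨i, ⟨s % (ℓ i * u.length), Nat.mod_lt _ (Nat.mul_pos (hℓ i) hk)⟩⟩)
      (q' := ⟨j, ⟨t % (ℓ j * u.length), Nat.mod_lt _ (Nat.mul_pos (hℓ j) hk)⟩⟩) h
    simpa [positionLetter, cyclicLetter_mod_mul] using this
  rintro ⟨i, s⟩ ⟨j, t⟩ (hst : trajectory ω.1 ω.2 u (x i) s = trajectory ω.1 ω.2 u (x j) t)
  have hshift (a : ℕ) : trajectory ω.1 ω.2 u (x i) (s + a)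
      = trajectory ω.1 ω.2 u (x j) (t + a) := by
    induction a with
    | zero => exact hst
    | succ a ih =>
      rw [← add_assoc, ← add_assoc, trajectory, trajectory, hletter i j _ _ ih, ih]
  have hmodEq : (s : ℕ) ≡ t [MOD u.length] := hu.modEq_of_shift fun a => hletter i j _ _ (hshift a)
  -- advance both trajectories to a multiple of the length of `u`
  obtain ⟨a, A, hA⟩ : ∃ a A, (s : ℕ) + a = A * u.length :=
    ⟨s * u.length - s, s, Nat.add_sub_cancel' (Nat.le_mul_of_pos_right _ hk)⟩
  obtain ⟨B, hB⟩ : ∃ B, (t : ℕ) + a = B * u.length := by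
    have h1 : (s : ℕ) + a ≡ t + a [MOD u.length] := hmodEq.add_right a
    have h2 : u.length ∣ t + a := (h1.dvd_iff dvd_rfl).1 ⟨A, by rw [hA, mul_comm]⟩
    obtain ⟨B, hB⟩ := h2
    exact ⟨B, by rw [hB, mul_comm]⟩
  have hAB := hshift a
  rw [hA, hB, trajectory_mul, trajectory_mul] at hAB
  have hij : i = j := by
    by_contra hij
    have hB' : B ≤ ℓ j * B := Nat.le_mul_of_pos_left _ (hℓ j)
    -- After `A` steps `x i` is where `x j` is after `B` steps; `ℓ j * B - B` further steps complete
    -- `B` turns and end at `x j`.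
    refine hx.2 i j hij (ℓ j * B - B + A) ?_
    rw [iterate_add_apply, hAB, ← iterate_add_apply, Nat.sub_add_cancel hB']
    exact IsPeriodicPt.mul_const (hper j) B
  subst hij
  have hAB' : A ≡ B [MOD ℓ i] := by
    rw [← iterate_mod_minimalPeriod_eq, ← iterate_mod_minimalPeriod_eq (n := B)] at hAB
    have hpos : 0 < minimalPeriod (wordMap ω.1 ω.2 u) (x i) := hx.1 i ▸ hℓ i
    have := (iterate_eq_iterate_iff_of_lt_minimalPeriod (Nat.mod_lt _ hpos)
      (Nat.mod_lt _ hpos)).1 hAB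
    rwa [hx.1 i] at this
  have hst' : (s : ℕ) + a ≡ t + a [MOD ℓ i * u.length] := by
    rw [hA, hB]
    exact hAB'.mul_right' _
  have := Nat.ModEq.add_right_cancel' a hst'
  have hfin : (s : ℕ) = t := this.eq_of_lt_of_lt s.2 t.2
  rw [Fin.ext hfin]

variable [Fintype α] [DecidableEq α]

open Classical in
theorem card_injective_le_card_isCycleTuple (hu : u ≠ []) (hℓ : ∀ i, 0 < ℓ i)
    (ω : (α → α) × (α → α)) :
    (Finset.univ.filter fun p : Position ℓ u.length → α =>
      IsClosedTrajectory (positionLetter u) positionNext ω p ∧ p.Injective).card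
      ≤ (Finset.univ.filter (IsCycleTuple (wordMap ω.1 ω.2 u) ℓ)).card := by
  have hk : 0 < u.length := List.length_pos_iff.2 hu
  have h0 (i : Fin r) (s : ℕ) : s % (ℓ i * u.length) < ℓ i * u.length :=
    Nat.mod_lt _ (Nat.mul_pos (hℓ i) hk)
  refine Finset.card_le_card_of_injOn
    (fun p i => p ⟨i, ⟨0 % (ℓ i * u.length), h0 i 0⟩⟩) ?_ ?_
  · intro p hp
    simp only [Finset.coe_filter, Finset.mem_univ, true_and, Set.mem_ofPred_eq] at hp ⊢
    exact hp.1.isCycleTuple hu hℓ hp.2 h0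
  · intro p hp p' hp' h
    simp only [Finset.coe_filter, Finset.mem_univ, true_and, Set.mem_ofPred_eq] at hp hp'
    ext ⟨i, t⟩
    have h1 := hp.1.apply_mod i (h0 i) t
    have h2 := hp'.1.apply_mod i (h0 i) t
    rw [show p ⟨i, ⟨0 % (ℓ i * u.length), h0 i 0⟩⟩ = p' ⟨i, ⟨0 % (ℓ i * u.length), h0 i 0⟩⟩ from
      congrFun h i, ← h2] at h1
    simpa [Nat.mod_eq_of_lt t.2] using h1

open Classical in
-- The walk of a cycle tuple either has more edges than points or is injective. With the lower bound
-- by injective walks, this brackets the number of cycle tuples.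
theorem IsPrimitive.card_isCycleTuple_le (hu : IsPrimitive u) (hℓ : ∀ i, 0 < ℓ i)
    (ω : (α → α) × (α → α)) :
    (Finset.univ.filter (IsCycleTuple (wordMap ω.1 ω.2 u) ℓ)).card
      ≤ (Finset.univ.filter fun p : Position ℓ u.length → α =>
        IsClosedTrajectory (positionLetter u) positionNext ω p ∧ p.Injective).card
      + (Finset.univ.filter fun p : Position ℓ u.length → α =>
        IsClosedTrajectory (positionLetter u) positionNext ω p ∧
          vertexCard p < edgeCard (positionLetter u) p).card := by
  have hk : 0 < u.length := List.length_pos_iff.2 hu.1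
  refine le_trans ?_ (Finset.card_union_le _ _)
  refine Finset.card_le_card_of_injOn (tupleTrajectory ω u ℓ) ?_ ?_
  · intro x hx
    simp only [Finset.coe_filter, Finset.mem_univ, true_and, Set.mem_ofPred_eq, Finset.coe_union,
      Set.mem_union] at hx ⊢
    have hc : IsClosedTrajectory (positionLetter u) positionNext ω (tupleTrajectory ω u ℓ x) :=
      isClosedTrajectory_tupleTrajectory fun i => by
        rw [← hx.1 i]; exact iterate_minimalPeriod
    by_cases he : vertexCard (tupleTrajectory ω u ℓ x)
        < edgeCard (positionLetter u) (tupleTrajectory ω u ℓ x)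
    · exact Or.inr ⟨hc, he⟩
    · exact Or.inl ⟨hc, hu.tupleTrajectory_injective hℓ hx (not_lt.1 he)⟩
  · intro x _ y _ h
    ext i
    exact congrFun h ⟨i, ⟨0, Nat.mul_pos (hℓ i) hk⟩⟩

end Moments

/-! ### Asymptotics of the factorial moments. -/

section Limits

theorem integral_law {n : ℕ} (X : Sample n → ℝ) :
    ∫ ω, X ω ∂law n = (∑ ω, X ω) / Fintype.card (Sample n) := by
  have h (ω : Sample n) : (law n).real {ω} = 1 / Fintype.card (Sample n) := by
    rw [measureReal_def, law, ← Set.singleton_prod_singleton, Measure.prod_prod, uniformOn_univ,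
      uniformOn_univ, Measure.count_singleton, Measure.count_singleton]
    simp
  rw [integral_fintype Integrable.of_finite, Finset.sum_div]
  refine Finset.sum_congr rfl fun ω _ => ?_
  rw [h, smul_eq_mul, one_div_mul_eq_div]

theorem tendsto_descFactorial_div_pow (k : ℕ) :
    Tendsto (fun n : ℕ => (n.descFactorial k : ℝ) / (n : ℝ) ^ k) atTop (𝓝 1) := by
  induction k with
  | zero => simp
  | succ k ih =>
    have h : Tendsto (fun n : ℕ => 1 - (k : ℝ) / n) atTop (𝓝 1) := by
      simpa using tendsto_const_nhds.sub (tendsto_const_div_atTop_nhds_zero_nat (k : ℝ))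
    have h2 := h.mul ih
    rw [one_mul] at h2
    refine h2.congr' ?_
    filter_upwards [eventually_gt_atTop k] with n hn
    have hn0 : (n : ℝ) ≠ 0 := Nat.cast_ne_zero.2 (by omega)
    rw [Nat.descFactorial_succ, Nat.cast_mul, Nat.cast_sub hn.le]
    field_simp
    ring

open Classical in
theorem IsPrimitive.average_card_isCycleTuple_bounds {α : Type*} [Fintype α] [DecidableEq α] [Nonempty α]
    {u : List Letter} (hu : IsPrimitive u) {r : ℕ} {ℓ : Fin r → ℕ} (hℓ : ∀ i, 0 < ℓ i) {T : ℕ}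
    (hT : Fintype.card (Position ℓ u.length) = T) :
    ((Fintype.card α).descFactorial T : ℝ) / (Fintype.card α : ℝ) ^ T ≤
      (∑ ω : (α → α) × (α → α),
        ((Finset.univ.filter (IsCycleTuple (wordMap ω.1 ω.2 u) ℓ)).card : ℝ))
        / Fintype.card ((α → α) × (α → α)) ∧
    (∑ ω : (α → α) × (α → α),
        ((Finset.univ.filter (IsCycleTuple (wordMap ω.1 ω.2 u) ℓ)).card : ℝ))
        / Fintype.card ((α → α) × (α → α)) ≤
      ((Fintype.card α).descFactorial T : ℝ) / (Fintype.card α : ℝ) ^ T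
        + (∑ v ∈ Finset.range (T + 1), (v : ℝ) ^ T) / Fintype.card α := by
  subst hT
  have hS : (0 : ℝ) < Fintype.card ((α → α) × (α → α)) := by exact_mod_cast Fintype.card_pos
  have hα : (0 : ℝ) < Fintype.card α := by exact_mod_cast Fintype.card_pos
  have hinj : ((Fintype.card α).descFactorial (Fintype.card (Position ℓ u.length)) : ℝ)
        / (Fintype.card α : ℝ) ^ Fintype.card (Position ℓ u.length)
      = (∑ ω : (α → α) × (α → α), ((Finset.univ.filter fun p : Position ℓ u.length → α =>
        IsClosedTrajectory (positionLetter u) positionNext ω p ∧ p.Injective).card : ℝ))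
        / Fintype.card ((α → α) × (α → α)) := by
    have h := sum_card_injective_isClosedTrajectory (β := α) (positionLetter u)
      (positionNext (ℓ := ℓ) (k := u.length))
    rw [div_eq_div_iff (by positivity) hS.ne', ← Nat.cast_sum, ← Nat.cast_pow, ← Nat.cast_mul,
      ← Nat.cast_mul, h]
  have hbad := sum_card_vertexCard_lt_edgeCard_le (β := α) (positionLetter u)
    (positionNext (ℓ := ℓ) (k := u.length))
  rw [hinj]
  constructor
  · refine div_le_div_of_nonneg_right (Finset.sum_le_sum fun ω _ => ?_) hS.le
    exact Nat.cast_le.2 (card_injective_le_card_isCycleTuple hu.1 hℓ ω)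
  · generalize (∑ v ∈ Finset.range (Fintype.card (Position ℓ u.length) + 1),
      (v : ℝ) ^ Fintype.card (Position ℓ u.length)) = C at hbad ⊢
    have hC : C / Fintype.card α = ((Fintype.card ((α → α) × (α → α)) : ℝ) / Fintype.card α * C)
        / Fintype.card ((α → α) × (α → α)) := by
      generalize (Fintype.card ((α → α) × (α → α)) : ℝ) = S at hS
      field_simp
    rw [hC, ← add_div]
    refine div_le_div_of_nonneg_right ?_ hS.le
    refine le_trans ?_ (add_le_add le_rfl hbad)
    rw [Nat.cast_sum, ← Finset.sum_add_distrib]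
    refine Finset.sum_le_sum fun ω _ => ?_
    rw [← Nat.cast_add]
    exact Nat.cast_le.2 (hu.card_isCycleTuple_le hℓ ω)

open Classical in
theorem IsPrimitive.tendsto_integral_card_isCycleTuple {u : List Letter} (hu : IsPrimitive u)
    {r : ℕ} {ℓ : Fin r → ℕ} (hℓ : ∀ i, 0 < ℓ i) :
    Tendsto (fun n => ∫ ω, ((Finset.univ.filter
      (IsCycleTuple (wordMap ω.1 ω.2 u) ℓ)).card : ℝ) ∂law n) atTop (𝓝 1) := by
  obtain ⟨T, hT⟩ : ∃ T, Fintype.card (Position ℓ u.length) = T := ⟨_, rfl⟩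
  have hlim := tendsto_descFactorial_div_pow T
  have hlim2 := hlim.add
    (tendsto_const_div_atTop_nhds_zero_nat (∑ v ∈ Finset.range (T + 1), (v : ℝ) ^ T))
  rw [add_zero] at hlim2
  have key (n : ℕ) (hn : 0 < n) := by
    have : Nonempty (Fin n) := ⟨⟨0, hn⟩⟩
    exact hu.average_card_isCycleTuple_bounds (α := Fin n) hℓ hT
  refine tendsto_of_tendsto_of_tendsto_of_le_of_le' hlim hlim2 ?_ ?_
  · filter_upwards [eventually_gt_atTop 0] with n hn
    rw [integral_law]
    simpa only [Fintype.card_fin] using (key n hn).1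
  · filter_upwards [eventually_gt_atTop 0] with n hn
    rw [integral_law]
    simpa only [Fintype.card_fin] using (key n hn).2

/-- An index `i : Fin M` stands for the length `i + 1`, and `l` lists the lengths of a tuple. The
mean number of such tuples tends to 1; dividing by the product of the lengths gives the moment. -/
theorem IsPrimitive.tendsto_factorialMoment {u : List Letter} (hu : IsPrimitive u) {M : ℕ}
    (l : List (Fin M)) :
    Tendsto (fun n => ∫ ω, ((∏ i : Fin M, (cycleCount (wordMap ω.1 ω.2 u) (i + 1)).descFactorial
      (l.count i) : ℕ) : ℝ) ∂law n) atTop (𝓝 (l.map fun i : Fin M => (1 : ℝ) / ((i : ℕ) + 1)).prod) := by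
  classical
  have hℓ (i : Fin l.length) : 0 < (l.get i : ℕ) + 1 := Nat.succ_pos _
  have h := (hu.tendsto_integral_card_isCycleTuple hℓ).const_mul
    (l.map fun i : Fin M => (1 : ℝ) / ((i : ℕ) + 1)).prod
  rw [mul_one] at h
  refine h.congr fun n => ?_
  rw [← integral_const_mul]
  refine integral_congr_ae (ae_of_all _ fun ω => ?_)
  have hinj : Function.Injective fun i : Fin M => (i : ℕ) + 1 := fun i j h => by
    simpa [Fin.ext_iff] using h
  have hcard := card_isCycleTuple (wordMap ω.1 ω.2 u) _ hℓ
    (Finset.univ.image fun i : Fin M => (i : ℕ) + 1) (fun i => by simp)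
  rw [Finset.prod_image hinj.injOn] at hcard
  have hcount (m : Fin M) : (Finset.univ.filter fun i : Fin l.length =>
      (l.get i : ℕ) + 1 = m + 1).card = l.count m := by
    have := Fin.card_filter_univ_eq_vector_get_eq_count m (⟨l, rfl⟩ : List.Vector (Fin M) _)
    refine Eq.trans ?_ this
    congr 1
    ext i
    simp [List.Vector.get, Fin.ext_iff, eq_comm]
  simp only [hcount] at hcard
  simp only [hcard]
  have hprod : (l.map fun i : Fin M => (1 : ℝ) / ((i : ℕ) + 1)).prod
      * ((∏ i : Fin l.length, ((l.get i : ℕ) + 1) : ℕ) : ℝ) = 1 := by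
    have : (∏ i : Fin l.length, ((l.get i : ℕ) + 1)) = (l.map fun i : Fin M => (i : ℕ) + 1).prod := by
      rw [← List.prod_ofFn]
      congr 1
      conv_rhs => rw [← List.ofFn_get l, List.map_ofFn]
      rfl
    rw [this]
    clear * -
    induction l with
    | nil => simp
    | cons a l ih =>
      simp only [List.map_cons, List.prod_cons]
      push_cast at ih ⊢
      rw [mul_mul_mul_comm, ih]
      field_simp
  rw [Nat.cast_mul, ← mul_assoc, hprod, one_mul]

end Limits
/-! ### Poisson convergence from factorial moments -/

section Factorial

variable {ι : Type*} [Fintype ι] [DecidableEq ι]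

/-- The product of the falling factorials of the coordinates of `v` prescribed by the
multiplicities of `l`. -/
def factorialProd (v : ι → ℕ) (l : List ι) : ℕ := ∏ i, (v i).descFactorial (l.count i)

theorem factorialProd_cons (v : ι → ℕ) (l : List ι) (i : ι) :
    factorialProd v (i :: l) = (v i - l.count i) * factorialProd v l :=
  prod_descFactorial_update _ v (fun j => l.count j) (fun j => (i :: l).count j)
    (Finset.mem_univ i) (by simp) fun j hj => by simp [hj.symm]

theorem factorialProd_nil (v : ι → ℕ) : factorialProd v [] = 1 := by
  simp [factorialProd]

theorem count_le_of_factorialProd_ne_zero {v : ι → ℕ} {l : List ι} (h : factorialProd v l ≠ 0)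
    (i : ι) : l.count i ≤ v i := by
  have := Finset.prod_ne_zero_iff.1 h i (Finset.mem_univ i)
  rwa [Ne, Nat.descFactorial_eq_zero_iff_lt, not_lt] at this

theorem sum_count_eq_length (l : List ι) : ∑ i, l.count i = l.length := by
  simpa using Multiset.sum_count_eq_card (s := Finset.univ) (m := (l : Multiset ι)) (by simp)

/-- One more object is chosen besides those recorded by `l`, and sorted by its type. Truncated
subtraction is harmless: `factorialProd v l` vanishes unless `l.count i ≤ v i` for all `i`. -/
theorem factorialProd_mul_sub (v : ι → ℕ) (l : List ι) :
    factorialProd v l * (∑ i, v i - l.length) = ∑ i, factorialProd v (i :: l) := by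
  simp only [factorialProd_cons, ← Finset.sum_mul]
  by_cases h : factorialProd v l = 0
  · simp [h]
  rw [Finset.sum_tsub_distrib _ fun i _ => count_le_of_factorialProd_ne_zero h i,
    sum_count_eq_length, mul_comm]

theorem descFactorial_succ_eq_mul_pred (n s : ℕ) :
    n.descFactorial (s + 1) = n * (n - 1).descFactorial s := by
  cases n with
  | zero => simp
  | succ n => exact Nat.succ_descFactorial_succ n s

theorem factorialProd_mul_descFactorial_succ (v : ι → ℕ) (l : List ι) (s : ℕ) :
    factorialProd v l * (∑ i, v i - l.length).descFactorial (s + 1)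
      = ∑ i, factorialProd v (i :: l) * (∑ j, v j - (i :: l).length).descFactorial s := by
  rw [descFactorial_succ_eq_mul_pred, ← mul_assoc, factorialProd_mul_sub, Finset.sum_mul]
  rfl

/-- A nonzero product forces `w ≤ v` coordinatewise, so comparing totals suffices to detect `v = w`.
Inclusion–exclusion is then needed for a single integer, the excess of the total. -/
theorem factorialProd_eq_indicator {v w : ι → ℕ} {l : List ι} (hl : ∀ i, l.count i = w i) :
    factorialProd v l * (if ∑ i, v i - l.length = 0 then 1 else 0)
      = (∏ i, (w i).factorial) * (if v = w then 1 else 0) := by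
  by_cases hvw : v = w
  · subst hvw
    rw [← sum_count_eq_length, Finset.sum_congr rfl fun i _ => hl i]
    simp [factorialProd, hl, Nat.descFactorial_self]
  · rw [if_neg hvw, mul_zero]
    by_contra hne
    have h0 := left_ne_zero_of_mul hne
    have h1 : ∑ i, v i - l.length = 0 := by
      by_contra h; simp [h] at hne
    have hle (i) : w i ≤ v i := hl i ▸ count_le_of_factorialProd_ne_zero h0 i
    rw [← sum_count_eq_length, Finset.sum_congr rfl fun i _ => hl i] at h1
    have hsum : ∑ i, w i = ∑ i, v i :=
      le_antisymm (Finset.sum_le_sum fun i _ => hle i) (Nat.sub_eq_zero_iff_le.1 h1)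
    refine hvw (funext fun i => ?_)
    exact ((Finset.sum_eq_sum_iff_of_le fun i _ => hle i).1 hsum i (Finset.mem_univ i)).symm

/-- Bonferroni's inequality for the expansion of (1 - 1)^M: for positive `M` and `S` the truncated
sum is, up to sign, `(M - 1).choose (S - 1)`. -/
theorem abs_indicator_sub_alternating_sum_le (M S : ℕ) :
    |(if M = 0 then 1 else 0 : ℝ) - ∑ s ∈ Finset.range S, (-1) ^ s * (M.choose s : ℝ)|
      ≤ M.choose S := by
  rcases S with _ | S
  · simp only [Finset.range_zero, Finset.sum_empty, sub_zero, Nat.choose_zero_right]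
    split_ifs <;> simp
  rcases M with _ | M
  · rw [Finset.sum_range_succ']
    simp
  · have h := Int.alternating_sum_range_choose_eq_choose (n := M) (m := S)
    have h' : ∑ s ∈ Finset.range (S + 1), (-1) ^ s * ((M + 1).choose s : ℝ)
        = (-1) ^ S * (M.choose S : ℝ) := by exact_mod_cast h
    rw [h', if_neg (Nat.succ_ne_zero M), zero_sub, abs_neg, abs_mul, abs_pow, abs_neg, abs_one,
      one_pow, one_mul, Nat.abs_cast, Nat.choose_succ_succ]
    exact_mod_cast Nat.le_add_right _ _

theorem exists_list_count (w : ι → ℕ) : ∃ l : List ι, ∀ i, l.count i = w i := by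
  refine ⟨(∑ i, w i • ({i} : Multiset ι)).toList, fun i => ?_⟩
  rw [← Multiset.coe_count, Multiset.coe_toList, Multiset.count_sum']
  simp [Multiset.count_singleton]

end Factorial

/-- A good `S` is fixed first, and only then does `n` grow. The filter is general so that `S` can be
a truncation order or a finite set of atoms. -/
theorem tendsto_of_approximation {σ : Type*} {F : Filter σ} [F.NeBot] {q : ℕ → ℝ}
    {A B : ℕ → σ → ℝ} {A' B' : σ → ℝ} {a : ℝ}
    (h : ∀ n S, |q n - A n S| ≤ B n S) (hA : ∀ S, Tendsto (fun n => A n S) atTop (𝓝 (A' S)))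
    (hB : ∀ S, Tendsto (fun n => B n S) atTop (𝓝 (B' S))) (hA' : Tendsto A' F (𝓝 a))
    (hB' : Tendsto B' F (𝓝 0)) : Tendsto q atTop (𝓝 a) := by
  rw [Metric.tendsto_nhds]
  intro ε hε
  obtain ⟨S, hS1, hS2⟩ := ((Metric.tendsto_nhds.1 hA' (ε / 4) (by positivity)).and
    (Metric.tendsto_nhds.1 hB' (ε / 4) (by positivity))).exists
  filter_upwards [Metric.tendsto_nhds.1 (hA S) (ε / 4) (by positivity),
    Metric.tendsto_nhds.1 (hB S) (ε / 4) (by positivity)] with n h1 h2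
  rw [Real.dist_eq, abs_lt] at *
  have := abs_le.1 (h n S)
  constructor <;> linarith

section Poisson

variable {ι : Type*} [Fintype ι] [DecidableEq ι] {Ω : ℕ → Type*} [∀ n, MeasurableSpace (Ω n)]
  [∀ n, Finite (Ω n)] [∀ n, MeasurableSingletonClass (Ω n)] {P : ∀ n, Measure (Ω n)}
  [∀ n, IsProbabilityMeasure (P n)] {V : ∀ n, Ω n → ι → ℕ} {lam : ι → NNReal}

theorem tendsto_integral_factorialProd_mul_descFactorial
    (hV : ∀ l : List ι, Tendsto (fun n => ∫ ω, (factorialProd (V n ω) l : ℝ) ∂P n) atTop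
      (𝓝 (l.map fun i => (lam i : ℝ)).prod)) (s : ℕ) (l : List ι) :
    Tendsto (fun n => ∫ ω, ((factorialProd (V n ω) l
      * (∑ i, V n ω i - l.length).descFactorial s : ℕ) : ℝ) ∂P n) atTop
      (𝓝 ((l.map fun i => (lam i : ℝ)).prod * (∑ i, (lam i : ℝ)) ^ s)) := by
  induction s generalizing l with
  | zero => simpa using hV l
  | succ s ih =>
    simp only [factorialProd_mul_descFactorial_succ, Nat.cast_sum]
    simp only [integral_finsetSum Finset.univ fun i _ => Integrable.of_finite]
    have := tendsto_finsetSum Finset.univ fun i (_ : i ∈ Finset.univ) => ih (i :: l)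
    convert this using 2
    rw [pow_succ', Finset.sum_mul, Finset.mul_sum]
    refine Finset.sum_congr rfl fun i _ => ?_
    simp only [List.map_cons, List.prod_cons]
    ring

/-- Up to the factor `c`, the event `V = w` has as indicator `factorialProd` times that of zero
excess. Expanding the latter to order S leaves an error tending to p Λ^S / S! in n, and the
alternating series sums to p exp(-Λ). -/
theorem tendsto_measureReal_of_factorialMoments
    (hV : ∀ l : List ι, Tendsto (fun n => ∫ ω, (factorialProd (V n ω) l : ℝ) ∂P n) atTop
      (𝓝 (l.map fun i => (lam i : ℝ)).prod)) (w : ι → ℕ) :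
    Tendsto (fun n => (P n).real {ω | V n ω = w}) atTop
      (𝓝 ((Measure.pi fun i => poissonMeasure (lam i)).real {w})) := by
  obtain ⟨l, hl⟩ := exists_list_count w
  set c : ℝ := ∏ i, ((w i).factorial : ℝ) with hc
  have hc0 : c ≠ 0 := Finset.prod_ne_zero_iff.2 fun i _ => by positivity
  set G : ℕ → ℕ → ℝ := fun n s => ∫ ω, ((factorialProd (V n ω) l
      * (∑ i, V n ω i - l.length).descFactorial s : ℕ) : ℝ) ∂P n with hG
  set p := (l.map fun i => (lam i : ℝ)).prod with hp
  set Λ := ∑ i, (lam i : ℝ) with hΛ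
  have hlim (s : ℕ) : Tendsto (fun n => G n s) atTop (𝓝 (p * Λ ^ s)) :=
    tendsto_integral_factorialProd_mul_descFactorial hV s l
  have key : Tendsto (fun n => c * (P n).real {ω | V n ω = w}) atTop (𝓝 (p * Real.exp (-Λ))) := by
    refine tendsto_of_approximation (F := atTop)
      (A := fun n S => ∑ s ∈ Finset.range S, (-1) ^ s / (s.factorial : ℝ) * G n s)
      (B := fun n S => G n S / S.factorial)
      (A' := fun S => ∑ s ∈ Finset.range S, (-1) ^ s / (s.factorial : ℝ) * (p * Λ ^ s))
      (B' := fun S => p * Λ ^ S / S.factorial) ?_ ?_ ?_ ?_ ?_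
    · intro n S
      have h1 : c * (P n).real {ω | V n ω = w} = ∫ ω, (factorialProd (V n ω) l : ℝ)
          * (if ∑ i, V n ω i - l.length = 0 then 1 else 0) ∂P n := by
        have (ω : Ω n) : (factorialProd (V n ω) l : ℝ)
            * (if ∑ i, V n ω i - l.length = 0 then 1 else 0)
            = c * Set.indicator {ω | V n ω = w} 1 ω := by
          have := factorialProd_eq_indicator (v := V n ω) hl
          have h2 : Set.indicator {ω | V n ω = w} (1 : Ω n → ℝ) ω
            = if V n ω = w then 1 else 0 := by simp [Set.indicator_apply]
          rw [h2, hc]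
          exact_mod_cast this
        simp only [this]
        rw [integral_const_mul, integral_indicator_one (Set.toFinite _).measurableSet]
      have h2 (s : ℕ) : (-1) ^ s / (s.factorial : ℝ) * G n s = ∫ ω, (factorialProd (V n ω) l : ℝ)
          * ((-1) ^ s * ((∑ i, V n ω i - l.length).choose s : ℝ)) ∂P n := by
        rw [hG, ← integral_const_mul]
        refine integral_congr_ae (ae_of_all _ fun ω => ?_)
        have : (s.factorial : ℝ) ≠ 0 := by positivity
        simp only [Nat.descFactorial_eq_factorial_mul_choose, Nat.cast_mul]
        field_simp
      have h3 : G n S / S.factorial = ∫ ω, (factorialProd (V n ω) l : ℝ)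
          * ((∑ i, V n ω i - l.length).choose S : ℝ) ∂P n := by
        rw [hG, ← integral_div]
        refine integral_congr_ae (ae_of_all _ fun ω => ?_)
        have : (S.factorial : ℝ) ≠ 0 := by positivity
        simp only [Nat.descFactorial_eq_factorial_mul_choose, Nat.cast_mul]
        field_simp
      simp only [h1, h2, h3]
      rw [← integral_finsetSum _ fun i _ => Integrable.of_finite,
        ← integral_sub Integrable.of_finite Integrable.of_finite, ← Real.norm_eq_abs]
      refine (norm_integral_le_integral_norm _).trans ?_
      refine integral_mono Integrable.of_finite Integrable.of_finite fun ω => ?_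
      simp only [Real.norm_eq_abs]
      rw [← Finset.mul_sum, ← mul_sub, abs_mul, Nat.abs_cast]
      exact mul_le_mul_of_nonneg_left (abs_indicator_sub_alternating_sum_le _ _) (by positivity)
    · intro S
      exact tendsto_finsetSum _ fun s _ => (hlim s).const_mul _
    · intro S
      exact (hlim S).div_const _
    · have h := (NormedSpace.expSeries_div_hasSum_exp (𝔸 := ℝ) (-Λ)).tendsto_sum_nat.const_mul p
      rw [← Real.exp_eq_exp_ℝ] at h
      refine h.congr fun S => ?_
      rw [Finset.mul_sum]
      refine Finset.sum_congr rfl fun s _ => ?_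
      rw [neg_pow]
      ring
    · have h := (FloorSemiring.tendsto_pow_div_factorial_atTop Λ).const_mul p
      rw [mul_zero] at h
      exact h.congr fun S => by ring
  have hpois : (Measure.pi fun i => poissonMeasure (lam i)).real {w} = c⁻¹ * (p * Real.exp (-Λ)) := by
    have hpl : p = ∏ i, (lam i : ℝ) ^ w i := by
      rw [hp, Finset.prod_list_map_count]
      refine (Finset.prod_subset (Finset.subset_univ _) fun i _ hi => ?_).trans
        (Finset.prod_congr rfl fun i _ => by rw [hl i])
      rw [List.count_eq_zero_of_not_mem (by simpa using hi), pow_zero]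
    rw [measureReal_def, Measure.pi_singleton, ENNReal.toReal_prod, hpl, hc, hΛ,
      ← Finset.sum_neg_distrib, Real.exp_sum, ← Finset.prod_mul_distrib, ← Finset.prod_inv_distrib,
      ← Finset.prod_mul_distrib]
    refine Finset.prod_congr rfl fun i _ => ?_
    rw [← measureReal_def, poissonMeasure_real_singleton]
    field_simp
  rw [hpois]
  refine (key.const_mul c⁻¹).congr fun n => ?_
  field_simp

end Poisson

/-- Pointwise convergence of probability mass functions to a probability mass function implies
convergence of the expectations of bounded functions. -/
theorem tendsto_integral_of_tendsto_singleton {κ : Type*} [Countable κ] [MeasurableSpace κ]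
    [MeasurableSingletonClass κ] {Q : Measure κ} [IsProbabilityMeasure Q] {Ω : ℕ → Type*}
    [∀ n, MeasurableSpace (Ω n)] [∀ n, Finite (Ω n)] [∀ n, MeasurableSingletonClass (Ω n)]
    {P : ∀ n, Measure (Ω n)} [∀ n, IsProbabilityMeasure (P n)] {V : ∀ n, Ω n → κ}
    (h : ∀ w, Tendsto (fun n => (P n).real {ω | V n ω = w}) atTop (𝓝 (Q.real {w})))
    {f : κ → ℝ} {B : ℝ} (hf : ∀ w, |f w| ≤ B) :
    Tendsto (fun n => ∫ ω, f (V n ω) ∂P n) atTop (𝓝 (∫ w, f w ∂Q)) := by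
  have hsum {g : κ → ℝ} (hg : Integrable g Q) :
      HasSum (fun w => g w * Q.real {w}) (∫ w, g w ∂Q) := by
    have := hasSum_integral_iUnion (μ := Q) (f := g) (s := fun w : κ => {w})
      (fun w => measurableSet_singleton w)
      (fun v w hvw => Set.disjoint_singleton.2 hvw) hg.integrableOn
    simpa [Set.iUnion_of_singleton, integral_singleton, mul_comm, measureReal_def] using this
  have hfint : Integrable f Q :=
    Integrable.of_bound (measurable_of_countable f).aestronglyMeasurable B (ae_of_all _ hf)
  -- Finite sets carry almost all the mass of `Q`, so no mass can escape in the limit.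
  have h1 := hsum (integrable_const (1 : ℝ))
  simp only [one_mul, integral_const, probReal_univ, smul_eq_mul, mul_one] at h1
  have hone := (tendsto_const_nhds (x := (1 : ℝ))).sub h1
  rw [sub_self] at hone
  refine tendsto_of_approximation (F := atTop)
    (A := fun n (s : Finset κ) => ∑ w ∈ s, f w * (P n).real {ω | V n ω = w})
    (B := fun n s => B * (1 - ∑ w ∈ s, (P n).real {ω | V n ω = w}))
    (A' := fun s => ∑ w ∈ s, f w * Q.real {w}) (B' := fun s => B * (1 - ∑ w ∈ s, Q.real {w}))
    ?_ ?_ ?_ (hsum hfint) ?_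
  · intro n s
    classical
    have hind (w : κ) : (P n).real {ω | V n ω = w}
        = ∫ ω, (if V n ω = w then 1 else 0 : ℝ) ∂P n := by
      rw [← integral_indicator_one (Set.toFinite _).measurableSet]
      refine integral_congr_ae (ae_of_all _ fun ω => ?_)
      simp [Set.indicator_apply]
    simp only [hind, ← integral_const_mul]
    rw [← integral_finsetSum _ fun i _ => Integrable.of_finite,
      ← integral_finsetSum _ fun i _ => Integrable.of_finite,
      ← integral_sub Integrable.of_finite Integrable.of_finite]
    have hB : (1 : ℝ) - ∫ ω, ∑ w ∈ s, (if V n ω = w then 1 else 0 : ℝ) ∂P n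
        = ∫ ω, (1 - ∑ w ∈ s, (if V n ω = w then 1 else 0 : ℝ)) ∂P n := by
      rw [integral_sub Integrable.of_finite Integrable.of_finite]
      simp
    rw [hB, ← integral_const_mul, ← Real.norm_eq_abs]
    refine (norm_integral_le_integral_norm _).trans ?_
    refine integral_mono Integrable.of_finite Integrable.of_finite fun ω => ?_
    simp only [Real.norm_eq_abs, mul_ite, mul_one, mul_zero, Finset.sum_ite_eq]
    by_cases hs : V n ω ∈ s
    · simp [hs]
    · simpa [hs] using hf (V n ω)
  · exact fun s => tendsto_finsetSum _ fun w _ => (h w).const_mul _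
  · exact fun s => (tendsto_const_nhds.sub (tendsto_finsetSum _ fun w _ => h w)).const_mul _
  · simpa using hone.const_mul B

/-! ### Cycles of an iterate -/

section Iterate

open Function

/-- Counting points by their minimal period `m` under `f` gives `j * C_j = ∑ m * C_m`, where `m = j
* gcd m d`. The latter also bounds `m` by `j * d`. -/
theorem cycleCount_iterate {α : Type*} [Finite α] (f : α → α) {d j K : ℕ} (hd : 0 < d) (hj : 0 < j)
    (hK : j * d ≤ K) :
    cycleCount f^[d] j = ∑ m ∈ (Finset.Icc 1 K).filter (fun m => m / Nat.gcd m d = j),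
      Nat.gcd m d * cycleCount f m := by
  classical
  have := Fintype.ofFinite α
  refine Nat.eq_of_mul_eq_mul_left hj ?_
  rw [← card_minimalPeriod_eq f^[d] hj, Finset.mul_sum,
    Finset.card_eq_sum_card_fiberwise (f := minimalPeriod f)
      (t := (Finset.Icc 1 K).filter fun m => m / Nat.gcd m d = j)]
  · refine Finset.sum_congr rfl fun m hm => ?_
    rw [Finset.mem_filter, Finset.mem_Icc] at hm
    obtain ⟨⟨hm1, -⟩, hmj⟩ := hm
    have hfil : (Finset.univ.filter fun x => minimalPeriod f^[d] x = j).filter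
        (fun x => minimalPeriod f x = m) = Finset.univ.filter fun x => minimalPeriod f x = m := by
      ext x
      simp only [Finset.mem_filter, Finset.mem_univ, true_and, and_iff_right_iff_imp]
      intro hx
      rw [minimalPeriod_iterate_eq_div_gcd hd.ne', hx, hmj]
    rw [hfil, card_minimalPeriod_eq f hm1, ← mul_assoc]
    congr 1
    rw [← hmj, Nat.div_mul_cancel (Nat.gcd_dvd_left m d)]
  · intro x hx
    simp only [Finset.coe_filter, Finset.mem_univ, true_and, Set.mem_ofPred_eq, Finset.mem_Icc]
      at hx ⊢
    rw [minimalPeriod_iterate_eq_div_gcd hd.ne'] at hx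
    refine ⟨⟨?_, ?_⟩, hx⟩
    · by_contra! h
      have h0 : minimalPeriod f x = 0 := by omega
      simp [h0] at hx
      omega
    · rw [← Nat.div_mul_cancel (Nat.gcd_dvd_left (minimalPeriod f x) d), hx]
      exact (Nat.mul_le_mul_left j (Nat.gcd_le_right _ hd)).trans hK

end Iterate

/-! ### Weights carried by the cycles of the primitive root. -/

section Coefficients

variable {d g : ℕ} [NeZero g]

/-- The coefficient with which a cycle of length `m` of `f` contributes to the weighted cycle count
of the iterate `f^[d]`. -/
noncomputable def cycleWeight (d g : ℕ) [NeZero g] (z : Fin g → ℂ) (L m : ℕ) : ℂ :=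
  if m / Nat.gcd m d ∈ Finset.Icc 1 L then z (Fin.ofNat g (m / Nat.gcd m d)) * (Nat.gcd m d : ℂ)
  else 0

theorem sum_cycleWeight (z : Fin g → ℂ) (L K : ℕ) (c : ℕ → ℂ) :
    ∑ j ∈ Finset.Icc 1 L, z (Fin.ofNat g j)
      * ∑ m ∈ (Finset.Icc 1 K).filter (fun m => m / Nat.gcd m d = j), (Nat.gcd m d : ℂ) * c m
      = ∑ m ∈ Finset.Icc 1 K, cycleWeight d g z L m * c m := by
  simp only [Finset.sum_filter, Finset.mul_sum]
  rw [Finset.sum_comm]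
  refine Finset.sum_congr rfl fun m _ => ?_
  simp only [mul_ite, mul_zero, Finset.sum_ite_eq, cycleWeight, ite_mul, zero_mul, mul_assoc]

theorem norm_cycleWeight_le (hd : 0 < d) (z : Fin g → ℂ) (L m : ℕ) :
    ‖cycleWeight d g z L m‖ ≤ (∑ i, ‖z i‖) * d := by
  unfold cycleWeight
  split_ifs
  · rw [norm_mul, Complex.norm_natCast]
    refine mul_le_mul ?_ ?_ (by positivity) (by positivity)
    · exact Finset.single_le_sum (f := fun i => ‖z i‖) (fun i _ => norm_nonneg _)
        (Finset.mem_univ _)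
    · exact_mod_cast Nat.gcd_le_right m hd
  · rw [norm_zero]; positivity

/-- The bijection is `c = d / gcd m d`, with inverse `m = j * (d / c)`; coprimality of `c` and `j`
says that `d / c` is the whole gcd of `m` and `d`. -/
theorem card_filter_div_gcd_eq {j K : ℕ} (hd : 0 < d) (hj : 0 < j) (hK : j * d ≤ K) :
    ((Finset.Icc 1 K).filter fun m => m / Nat.gcd m d = j).card
      = (d.divisors.filter fun c => Nat.gcd c j = 1).card := by
  refine Finset.card_bij' (fun m _ => d / Nat.gcd m d) (fun c _ => j * (d / c)) ?_ ?_ ?_ ?_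
  · intro m hm
    simp only [Finset.mem_filter, Finset.mem_Icc, Nat.mem_divisors] at hm ⊢
    refine ⟨⟨Nat.div_dvd_of_dvd (Nat.gcd_dvd_right m d), hd.ne'⟩, ?_⟩
    rw [← hm.2, Nat.gcd_comm]
    exact Nat.coprime_div_gcd_div_gcd (Nat.gcd_pos_of_pos_right m hd)
  · intro c hc
    simp only [Finset.mem_filter, Finset.mem_Icc, Nat.mem_divisors] at hc ⊢
    obtain ⟨⟨⟨e, rfl⟩, -⟩, hcj⟩ := hc
    have hc0 : 0 < c := Nat.pos_of_mul_pos_right hd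
    have he0 : 0 < e := Nat.pos_of_mul_pos_left hd
    rw [Nat.mul_div_cancel_left e hc0, Nat.gcd_mul_right, Nat.gcd_comm, hcj, one_mul]
    refine ⟨⟨Nat.mul_pos hj he0, le_trans ?_ hK⟩, Nat.mul_div_cancel j he0⟩
    exact Nat.mul_le_mul_left j (Nat.le_mul_of_pos_left e hc0)
  · intro m hm
    simp only [Finset.mem_filter, Finset.mem_Icc] at hm
    rw [Nat.div_div_self (Nat.gcd_dvd_right m d) hd.ne', ← hm.2]
    exact Nat.div_mul_cancel (Nat.gcd_dvd_left m d)
  · intro c hc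
    simp only [Finset.mem_filter, Nat.mem_divisors] at hc
    obtain ⟨⟨⟨e, rfl⟩, -⟩, hcj⟩ := hc
    have hc0 : 0 < c := Nat.pos_of_mul_pos_right hd
    have he0 : 0 < e := Nat.pos_of_mul_pos_left hd
    rw [Nat.mul_div_cancel_left e hc0, Nat.gcd_mul_right, Nat.gcd_comm, hcj, one_mul,
      Nat.mul_div_cancel c he0]

theorem sum_cycleWeight_div (hd : 0 < d) (z : Fin g → ℂ) (L : ℕ) :
    ∑ m ∈ Finset.Icc 1 (L * d), cycleWeight d g z L m * (1 / (m : ℂ))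
      = ∑ j ∈ Finset.Icc 1 L, z (Fin.ofNat g j)
        * ((d.divisors.filter fun c => Nat.gcd c j = 1).card : ℂ) / j := by
  rw [← sum_cycleWeight]
  refine Finset.sum_congr rfl fun j hj => ?_
  rw [Finset.mem_Icc] at hj
  rw [← card_filter_div_gcd_eq hd hj.1 (Nat.mul_le_mul_right d hj.2), mul_div_assoc]
  congr 1
  rw [div_eq_mul_one_div, ← nsmul_eq_mul, ← Finset.sum_const]
  refine Finset.sum_congr rfl fun m hm => ?_
  rw [Finset.mem_filter, Finset.mem_Icc] at hm
  have h0 : (Nat.gcd m d : ℂ) ≠ 0 := by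
    exact_mod_cast (Nat.gcd_pos_of_pos_right m hd).ne'
  have hm' : (m : ℂ) = j * (Nat.gcd m d : ℂ) := by
    rw [← hm.2]
    exact_mod_cast (Nat.div_mul_cancel (Nat.gcd_dvd_left m d)).symm
  have hj0 : (j : ℂ) ≠ 0 := Nat.cast_ne_zero.2 (by omega)
  rw [hm']
  field_simp

end Coefficients

/-! ### Logarithmic averages of periodic sequences -/

section LogAverage

theorem exists_norm_sum_range_le_of_periodic {f : ℕ → ℂ} {M : ℕ} (hM : 0 < M)
    (hf : ∀ i, f (i + M) = f i) (h0 : ∑ i ∈ Finset.range M, f i = 0) : ∃ B, ∀ n, ‖∑ i ∈ Finset.range n, f i‖ ≤ B := by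
  have hshift (n : ℕ) : ∑ i ∈ Finset.range (n + M), f i = ∑ i ∈ Finset.range n, f i := by
    rw [add_comm, Finset.sum_range_add, h0, zero_add]
    exact Finset.sum_congr rfl fun i _ => by rw [add_comm, hf]
  have hper : Function.Periodic (fun n => ∑ i ∈ Finset.range n, f i) M := hshift
  refine ⟨∑ i ∈ Finset.range M, ‖f i‖, fun n => ?_⟩
  rw [← hper.map_mod_nat n]
  refine (norm_sum_le _ _).trans ?_
  exact Finset.sum_le_sum_of_subset_of_nonneg
    (Finset.range_subset_range.2 (Nat.mod_lt n hM).le) fun i _ _ => norm_nonneg _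

theorem tendsto_log_natCast_atTop : Tendsto (fun L : ℕ => Real.log (L : ℝ)) atTop atTop :=
  Real.tendsto_log_atTop.comp tendsto_natCast_atTop_atTop

theorem tendsto_harmonic_div_log :
    Tendsto (fun L : ℕ => (harmonic L : ℝ) / Real.log (L : ℝ)) atTop (𝓝 1) := by
  have h := (Real.tendsto_harmonic_sub_log.div_atTop tendsto_log_natCast_atTop).const_add 1
  rw [add_zero] at h
  refine h.congr' ?_
  filter_upwards [tendsto_log_natCast_atTop.eventually_gt_atTop 0] with L hL
  field_simp
  ring

/-- Subtract the mean `μ`. The centred sequence has bounded partial sums, so its series against 1/j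
converges by Dirichlet's test and is killed by `log L`. What remains is `μ` times the harmonic
number over `log L`. -/
theorem tendsto_logAverage_of_periodic {h : ℕ → ℂ} {M : ℕ} (hM : 0 < M)
    (hh : ∀ i, h (i + M) = h i) :
    Tendsto (fun L : ℕ => (∑ j ∈ Finset.Icc 1 L, h j / (j : ℂ)) / ((Real.log (L : ℝ) : ℝ) : ℂ))
      atTop (𝓝 (1 / (M : ℂ) * ∑ r ∈ Finset.Icc 1 M, h r)) := by
  set μ := 1 / (M : ℂ) * ∑ r ∈ Finset.Icc 1 M, h r with hμ
  have hIcc (f : ℕ → ℂ) (n : ℕ) : ∑ j ∈ Finset.Icc 1 n, f j = ∑ i ∈ Finset.range n, f (i + 1) := by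
    rw [Finset.range_eq_Ico, Finset.sum_Ico_add' f 0 n 1]
    rfl
  have hM0 : (M : ℂ) ≠ 0 := Nat.cast_ne_zero.2 hM.ne'
  have hmean : ∑ i ∈ Finset.range M, (h (i + 1) - μ) = 0 := by
    rw [Finset.sum_sub_distrib, ← hIcc, Finset.sum_const, Finset.card_range, nsmul_eq_mul, hμ]
    field_simp
    ring
  obtain ⟨B, hB⟩ := exists_norm_sum_range_le_of_periodic hM
    (fun i => by rw [Nat.add_right_comm, hh]) hmean
  have hcauchy := (show Antitone fun i : ℕ => 1 / ((i : ℝ) + 1) from fun i j hij =>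
    one_div_le_one_div_of_le (by positivity)
      (by gcongr)).cauchySeq_series_mul_of_tendsto_zero_of_bounded
        tendsto_one_div_add_atTop_nhds_zero_nat hB
  obtain ⟨s, hs⟩ := cauchySeq_tendsto_of_complete hcauchy
  have hloginv : Tendsto (fun L : ℕ => ((Real.log (L : ℝ))⁻¹ : ℂ)) atTop (𝓝 0) := by
    have := (tendsto_inv_atTop_zero.comp tendsto_log_natCast_atTop)
    have h2 := (Complex.continuous_ofReal.tendsto 0).comp this
    simpa [Function.comp_def] using h2
  have h1 := hs.mul hloginv
  have h2 := ((Complex.continuous_ofReal.tendsto 1).comp tendsto_harmonic_div_log).const_mul μ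
  have h3 := h1.add h2
  rw [mul_zero, zero_add, Complex.ofReal_one, mul_one] at h3
  refine h3.congr fun L => ?_
  simp only [Function.comp_apply, Complex.ofReal_div]
  rw [← div_eq_mul_inv, ← mul_div_assoc, ← add_div]
  congr 1
  rw [hIcc, harmonic, Rat.cast_sum, Complex.ofReal_sum, Finset.mul_sum, ← Finset.sum_add_distrib]
  refine Finset.sum_congr rfl fun i _ => ?_
  have : ((i : ℂ) + 1) ≠ 0 := by exact_mod_cast Nat.succ_ne_zero i
  simp only [Complex.real_smul]
  push_cast
  field_simp
  ring

/-- For `c ∣ d`, gcd(c, j) depends only on j modulo d, so the summand has period lcm(d, g). -/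
theorem tendsto_logAverage_rho {d g : ℕ} [NeZero g] (hd : 0 < d) (z : Fin g → ℂ) :
    Tendsto (fun L : ℕ => (∑ m ∈ Finset.Icc 1 (L * d), cycleWeight d g z L m * (1 / (m : ℂ)))
      / ((Real.log (L : ℝ) : ℝ) : ℂ)) atTop (𝓝 (rho d g z)) := by
  simp only [sum_cycleWeight_div hd]
  refine tendsto_logAverage_of_periodic (Nat.lcm_pos hd (NeZero.pos g)) fun i => ?_
  congr 2
  · refine Fin.ext ?_
    simp only [Fin.ofNat]
    obtain ⟨e, he⟩ := Nat.dvd_lcm_right d g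
    rw [he, Nat.add_mul_mod_self_left]
  · refine congrArg Finset.card (Finset.filter_congr fun c hc => ?_)
    obtain ⟨e, he⟩ := (Nat.dvd_of_mem_divisors hc).trans (Nat.dvd_lcm_left d g)
    rw [he, Nat.gcd_add_mul_left_right]

end LogAverage
/-! ### The weighted cycle count in terms of the primitive root -/

section PrimitiveRoot

/-- The numbers of cycles of length `1, …, M` of the transition of `u`. -/
noncomputable def cycleVector (u : List Letter) (M n : ℕ) (ω : Sample n) (i : Fin M) : ℕ :=
  cycleCount (wordMap ω.1 ω.2 u) (i + 1)

/-- The linear functional through which the normalised count depends on the cycle vector. -/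
noncomputable def normFunctional (d g : ℕ) [NeZero g] (z : Fin g → ℂ) (L : ℕ)
    (v : Fin (L * d) → ℝ) : ℂ :=
  (∑ i : Fin (L * d), cycleWeight d g z L ((i : ℕ) + 1) * (v i : ℂ)) / ((Real.log (L : ℝ) : ℝ) : ℂ)

theorem sum_Icc_one_eq_sum_fin (f : ℕ → ℂ) (M : ℕ) :
    ∑ m ∈ Finset.Icc 1 M, f m = ∑ i : Fin M, f ((i : ℕ) + 1) := by
  rw [Fin.sum_univ_eq_sum_range (fun i => f (i + 1)), Finset.range_eq_Ico,
    Finset.sum_Ico_add' f 0 M 1]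
  rfl

theorem normCount_wordPow (u : List Letter) {d : ℕ} (hd : 0 < d) (g : ℕ) [NeZero g]
    (z : Fin g → ℂ) (n L : ℕ) (ω : Sample n) :
    normCount (wordPow u d) g z n L ω
      = normFunctional d g z L fun i => (cycleVector u (L * d) n ω i : ℝ) := by
  unfold normCount normFunctional weightedCount cycleVector
  congr 1
  refine Eq.trans ?_ ((sum_cycleWeight (d := d) z L (L * d)
    fun m => (cycleCount (wordMap ω.1 ω.2 u) m : ℂ)).trans ?_)
  · refine Finset.sum_congr rfl fun j hj => ?_
    rw [Finset.mem_Icc] at hj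
    rw [wordMap_wordPow, cycleCount_iterate _ hd hj.1 (Nat.mul_le_mul_right d hj.2)]
    push_cast
    rfl
  · rw [sum_Icc_one_eq_sum_fin]
    simp

/-- The limiting law of the cycle vector: independent Poisson variables of parameters
`1, 1/2, …, 1/M`. -/
noncomputable def cycleVectorLimit (M : ℕ) : Measure (Fin M → ℕ) :=
  Measure.pi fun i => poissonMeasure (1 / ((i : ℕ) + 1))

instance instIsProbabilityMeasureCycleVectorLimit (M : ℕ) :
    IsProbabilityMeasure (cycleVectorLimit M) := by
  unfold cycleVectorLimit
  infer_instance

/-! ### Joint Poisson limit and limiting moments of the cycle vector. -/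

variable {u : List Letter}

theorem IsPrimitive.tendsto_integral_factorialProd (hu : IsPrimitive u) {M : ℕ}
    (l : List (Fin M)) :
    Tendsto (fun n => ∫ ω, (factorialProd (cycleVector u M n ω) l : ℝ) ∂law n) atTop
      (𝓝 (l.map fun i : Fin M => (1 : ℝ) / ((i : ℕ) + 1)).prod) :=
  hu.tendsto_factorialMoment l

theorem IsPrimitive.tendsto_integral_cycleVector (hu : IsPrimitive u) (M : ℕ)
    {f : (Fin M → ℕ) → ℝ} {B : ℝ} (hf : ∀ v, |f v| ≤ B) :
    Tendsto (fun n => ∫ ω, f (cycleVector u M n ω) ∂law n) atTop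
      (𝓝 (∫ v, f v ∂cycleVectorLimit M)) := by
  refine tendsto_integral_of_tendsto_singleton (fun w => ?_) hf
  refine tendsto_measureReal_of_factorialMoments (V := fun n => cycleVector u M n) (fun l => ?_) w
  simpa using hu.tendsto_integral_factorialProd l

theorem IsPrimitive.tendsto_mean (hu : IsPrimitive u) {M : ℕ} (i : Fin M) :
    Tendsto (fun n => ∫ ω, (cycleVector u M n ω i : ℝ) ∂law n) atTop
      (𝓝 (1 / ((i : ℕ) + 1))) := by
  have h := hu.tendsto_integral_factorialProd [i]
  simpa [factorialProd_cons, factorialProd_nil] using h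

/-- On the diagonal the square exceeds the second falling factorial by `v i`, and the mean of this
term is all that survives. -/
theorem IsPrimitive.tendsto_covariance (hu : IsPrimitive u) {M : ℕ} (i j : Fin M) :
    Tendsto (fun n => ∫ ω, ((cycleVector u M n ω i : ℝ) - 1 / ((i : ℕ) + 1))
        * ((cycleVector u M n ω j : ℝ) - 1 / ((j : ℕ) + 1)) ∂law n) atTop
      (𝓝 (if i = j then 1 / ((i : ℕ) + 1) else 0)) := by
  have h2 := hu.tendsto_integral_factorialProd [i, j]
  have hi := hu.tendsto_mean i
  have hj := hu.tendsto_mean j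
  have hprod (v : Fin M → ℕ) : ((v i : ℝ) - 1 / ((i : ℕ) + 1)) * ((v j : ℝ) - 1 / ((j : ℕ) + 1))
      = (factorialProd v [i, j] : ℝ) + (if i = j then 1 else 0) * (v i : ℝ)
        - 1 / ((j : ℕ) + 1) * (v i : ℝ) - 1 / ((i : ℕ) + 1) * (v j : ℝ)
        + 1 / ((i : ℕ) + 1) * (1 / ((j : ℕ) + 1)) := by
    by_cases hij : i = j
    · subst hij
      have : (factorialProd v [i, i] : ℝ) = (v i : ℝ) * (v i - 1) := by
        rcases Nat.eq_zero_or_pos (v i) with h | h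
        · simp [factorialProd_cons, factorialProd_nil, h]
        · simp [factorialProd_cons, factorialProd_nil, Nat.cast_sub h]
          ring
      rw [this]
      simp
      ring
    · have : (factorialProd v [i, j] : ℝ) = (v i : ℝ) * v j := by
        simp [factorialProd_cons, factorialProd_nil, Ne.symm hij]
      rw [this]
      simp [hij]
      ring
  simp only [hprod]
  have hlim := (((h2.add (hi.const_mul (if i = j then 1 else 0 : ℝ))).sub
    (hi.const_mul (1 / ((j : ℕ) + 1) : ℝ))).sub (hj.const_mul (1 / ((i : ℕ) + 1) : ℝ))).add
      (tendsto_const_nhds (x := (1 / ((i : ℕ) + 1) * (1 / ((j : ℕ) + 1)) : ℝ)))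
  convert hlim using 2 with n
  · rw [integral_add Integrable.of_finite Integrable.of_finite,
      integral_sub Integrable.of_finite Integrable.of_finite,
      integral_sub Integrable.of_finite Integrable.of_finite,
      integral_add Integrable.of_finite Integrable.of_finite,
      integral_const_mul, integral_const_mul, integral_const_mul, integral_const]
    simp
  · simp
    ring

theorem IsPrimitive.tendsto_secondMoment (hu : IsPrimitive u) {M : ℕ} (b : Fin M → ℝ) :
    Tendsto (fun n => ∫ ω, (∑ i, b i * ((cycleVector u M n ω i : ℝ) - 1 / ((i : ℕ) + 1))) ^ 2
        ∂law n) atTop (𝓝 (∑ i, b i ^ 2 * (1 / ((i : ℕ) + 1)))) := by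
  have h := tendsto_finsetSum Finset.univ fun i (_ : i ∈ Finset.univ) =>
    tendsto_finsetSum Finset.univ fun j (_ : j ∈ Finset.univ) =>
      (hu.tendsto_covariance (M := M) i j).const_mul (b i * b j)
  have hlim : ∑ i : Fin M, ∑ j : Fin M, b i * b j * (if i = j then (1 : ℝ) / ((i : ℕ) + 1) else 0)
      = ∑ i, b i ^ 2 * (1 / ((i : ℕ) + 1)) := by
    simp [pow_two]
  rw [hlim] at h
  refine h.congr fun n => ?_
  have hsq (Y : Fin M → ℝ) : (∑ i, b i * Y i) ^ 2 = ∑ i, ∑ j, b i * b j * (Y i * Y j) := by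
    rw [pow_two, Finset.sum_mul_sum]
    exact Finset.sum_congr rfl fun i _ => Finset.sum_congr rfl fun j _ => by ring
  simp only [hsq]
  rw [integral_finsetSum _ fun i _ => Integrable.of_finite]
  refine Finset.sum_congr rfl fun i _ => ?_
  rw [integral_finsetSum _ fun i _ => Integrable.of_finite]
  exact Finset.sum_congr rfl fun j _ => (integral_const_mul _ _).symm

/-! ### Mean, variance and deviations of the normalised count. -/

variable {d g : ℕ} [NeZero g]

theorem normFunctional_sub (z : Fin g → ℂ) (L : ℕ) (v w : Fin (L * d) → ℝ) :
    normFunctional d g z L v - normFunctional d g z L w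
      = normFunctional d g z L fun i => v i - w i := by
  unfold normFunctional
  rw [← sub_div, ← Finset.sum_sub_distrib]
  congr 1
  refine Finset.sum_congr rfl fun i _ => ?_
  push_cast
  ring

theorem norm_sq_normFunctional (z : Fin g → ℂ) (L : ℕ) (v : Fin (L * d) → ℝ) :
    ‖normFunctional d g z L v‖ ^ 2
      = ((∑ i : Fin (L * d), (cycleWeight d g z L ((i : ℕ) + 1)).re * v i) ^ 2
        + (∑ i : Fin (L * d), (cycleWeight d g z L ((i : ℕ) + 1)).im * v i) ^ 2) / Real.log L ^ 2 := by
  rw [normFunctional, norm_div, div_pow, Complex.norm_real, Real.norm_eq_abs, sq_abs,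
    ← Complex.normSq_eq_norm_sq, Complex.normSq_apply, Complex.re_sum, Complex.im_sum]
  simp [pow_two]

/-- The limit of the expectations, as the number of points tends to infinity. -/
noncomputable def limitMean (d g : ℕ) [NeZero g] (z : Fin g → ℂ) (L : ℕ) : ℂ :=
  normFunctional d g z L fun i => 1 / ((i : ℕ) + 1)

/-- The limit of the variances, as the number of points tends to infinity. -/
noncomputable def limitVariance (d g : ℕ) [NeZero g] (z : Fin g → ℂ) (L : ℕ) : ℝ :=
  (∑ i : Fin (L * d), ‖cycleWeight d g z L ((i : ℕ) + 1)‖ ^ 2 * (1 / ((i : ℕ) + 1)))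
    / Real.log L ^ 2

theorem tendsto_limitMean (hd : 0 < d) (z : Fin g → ℂ) :
    Tendsto (limitMean d g z) atTop (𝓝 (rho d g z)) := by
  refine (tendsto_logAverage_rho hd z).congr fun L => ?_
  rw [sum_Icc_one_eq_sum_fin, limitMean, normFunctional]
  push_cast
  rfl

/-- The weights are bounded, so the numerator is at most a constant times the harmonic number of `L
* d`, of order `log L`, against `log L ^ 2`. -/
theorem tendsto_limitVariance (hd : 0 < d) (z : Fin g → ℂ) :
    Tendsto (limitVariance d g z) atTop (𝓝 0) := by
  set A := ((∑ i, ‖z i‖) * d) ^ 2 with hA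
  have h1 := tendsto_log_natCast_atTop.inv_tendsto_atTop
  have h2 : Tendsto (fun L : ℕ => A * ((1 + Real.log d + Real.log L) / Real.log L ^ 2)) atTop
      (𝓝 0) := by
    have h3 := (((h1.pow 2).const_mul (1 + Real.log d)).add h1).const_mul A
    simp only [ne_eq, OfNat.ofNat_ne_zero, not_false_eq_true, zero_pow, mul_zero, add_zero] at h3
    refine h3.congr' ?_
    filter_upwards [tendsto_log_natCast_atTop.eventually_gt_atTop 0] with L hL
    simp only [Pi.inv_apply]
    field_simp
  refine squeeze_zero' (Eventually.of_forall fun L => ?_) ?_ h2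
  · unfold limitVariance
    positivity
  · filter_upwards [eventually_gt_atTop 0] with L hL
    rw [limitVariance, ← mul_div_assoc]
    refine div_le_div_of_nonneg_right ?_ (by positivity)
    have hlog : (harmonic (L * d) : ℝ) ≤ 1 + Real.log d + Real.log L := by
      refine (harmonic_le_one_add_log _).trans_eq ?_
      rw [Nat.cast_mul, Real.log_mul (by positivity) (by positivity)]
      ring
    refine le_trans ?_ (mul_le_mul_of_nonneg_left hlog (by positivity))
    rw [harmonic, Rat.cast_sum, Finset.mul_sum,
      ← Fin.sum_univ_eq_sum_range (fun i => A * (((((i + 1 : ℕ) : ℚ))⁻¹ : ℚ) : ℝ))]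
    refine Finset.sum_le_sum fun i _ => ?_
    push_cast
    rw [one_div]
    refine mul_le_mul_of_nonneg_right ?_ (by positivity)
    exact pow_le_pow_left₀ (norm_nonneg _) (norm_cycleWeight_le hd z L _) 2

theorem IsPrimitive.tendsto_integral_norm_sq (hu : IsPrimitive u) (z : Fin g → ℂ) (L : ℕ) :
    Tendsto (fun n => ∫ ω, ‖normFunctional d g z L (fun i => (cycleVector u (L * d) n ω i : ℝ))
      - limitMean d g z L‖ ^ 2 ∂law n) atTop (𝓝 (limitVariance d g z L)) := by
  simp only [limitMean, normFunctional_sub, norm_sq_normFunctional]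
  have hre := hu.tendsto_secondMoment fun i : Fin (L * d) => (cycleWeight d g z L ((i : ℕ) + 1)).re
  have him := hu.tendsto_secondMoment fun i : Fin (L * d) => (cycleWeight d g z L ((i : ℕ) + 1)).im
  have hlim : limitVariance d g z L
      = (∑ i : Fin (L * d), (cycleWeight d g z L ((i : ℕ) + 1)).re ^ 2 * (1 / ((i : ℕ) + 1))
        + ∑ i : Fin (L * d), (cycleWeight d g z L ((i : ℕ) + 1)).im ^ 2 * (1 / ((i : ℕ) + 1)))
          / Real.log L ^ 2 := by
    rw [limitVariance, ← Finset.sum_add_distrib]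
    congr 1
    refine Finset.sum_congr rfl fun i _ => ?_
    rw [← Complex.normSq_eq_norm_sq, Complex.normSq_apply]
    ring
  rw [hlim]
  refine ((hre.add him).div_const _).congr fun n => ?_
  rw [integral_div, integral_add Integrable.of_finite Integrable.of_finite]

theorem IsPrimitive.tendsto_integral_normFunctional (hu : IsPrimitive u) (z : Fin g → ℂ) (L : ℕ) :
    Tendsto (fun n => ∫ ω, normFunctional d g z L (fun i => (cycleVector u (L * d) n ω i : ℝ))
      ∂law n) atTop (𝓝 (limitMean d g z L)) := by
  unfold limitMean normFunctional
  have h := (tendsto_finsetSum Finset.univ fun i (_ : i ∈ Finset.univ) =>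
    ((Complex.continuous_ofReal.tendsto _).comp (hu.tendsto_mean (M := L * d) i)).const_mul
      (cycleWeight d g z L ((i : ℕ) + 1))).div_const ((Real.log (L : ℝ) : ℝ) : ℂ)
  refine h.congr fun n => ?_
  rw [integral_div, integral_finsetSum _ fun i _ => Integrable.of_finite]
  congr 1
  refine Finset.sum_congr rfl fun i _ => ?_
  rw [integral_const_mul, Function.comp_apply]
  congr 1
  exact integral_ofReal.symm

/-- The limiting probability of a deviation from `x` by more than `ε`. -/
noncomputable def limitDeviation (d g : ℕ) [NeZero g] (z : Fin g → ℂ) (x : ℂ) (ε : ℝ) (L : ℕ) : ℝ :=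
  (cycleVectorLimit (L * d)).real
    {v | ε < ‖normFunctional d g z L (fun i => (v i : ℝ)) - x‖}

/-- The event need not be a continuity set of the limit law. Convergence of the atoms covers all
bounded test functions, hence every `ε`. -/
theorem IsPrimitive.tendsto_deviation (hu : IsPrimitive u) (z : Fin g → ℂ) (x : ℂ) (ε : ℝ)
    (L : ℕ) :
    Tendsto (fun n => (law n).real
      {ω | ε < ‖normFunctional d g z L (fun i => (cycleVector u (L * d) n ω i : ℝ)) - x‖}) atTop
      (𝓝 (limitDeviation d g z x ε L)) := by
  have h := hu.tendsto_integral_cycleVector (L * d) (B := 1) (f := Set.indicator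
    {v | ε < ‖normFunctional d g z L (fun i => (v i : ℝ)) - x‖} 1) fun v => by
      by_cases hv : v ∈ {v : Fin (L * d) → ℕ | ε < ‖normFunctional d g z L (fun i => (v i : ℝ)) - x‖}
      · simp [Set.indicator_of_mem hv]
      · simp [Set.indicator_of_notMem hv]
  rw [integral_indicator_one (Set.to_countable _).measurableSet] at h
  refine h.congr fun n => ?_
  rw [← integral_indicator_one (Set.toFinite _).measurableSet]
  rfl

/-- Chebyshev's inequality around `limitMean` for each `n`, passed to the limit. Half of `ε` absorbs
the distance from the mean to `x`, whence the factor 4. -/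
theorem IsPrimitive.limitDeviation_le (hu : IsPrimitive u) (z : Fin g → ℂ) {x : ℂ} {ε : ℝ}
    (hε : 0 < ε) {L : ℕ} (hL : ‖limitMean d g z L - x‖ < ε / 2) :
    limitDeviation d g z x ε L ≤ 4 / ε ^ 2 * limitVariance d g z L := by
  refine le_of_tendsto_of_tendsto' (hu.tendsto_deviation z x ε L)
    ((hu.tendsto_integral_norm_sq z L).const_mul (4 / ε ^ 2)) fun n => ?_
  rw [← integral_indicator_one (Set.toFinite _).measurableSet, ← integral_const_mul]
  refine integral_mono Integrable.of_finite Integrable.of_finite fun ω => ?_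
  by_cases hω : ω ∈
      {ω | ε < ‖normFunctional d g z L (fun i => (cycleVector u (L * d) n ω i : ℝ)) - x‖}
  · rw [Set.indicator_of_mem hω, Pi.one_apply]
    rw [Set.mem_ofPred_eq] at hω
    have htri := norm_sub_le_norm_sub_add_norm_sub
      (normFunctional d g z L fun i => (cycleVector u (L * d) n ω i : ℝ)) (limitMean d g z L) x
    have hge : ε / 2 ≤ ‖normFunctional d g z L (fun i => (cycleVector u (L * d) n ω i : ℝ))
        - limitMean d g z L‖ := by linarith
    calc (1 : ℝ) = 4 / ε ^ 2 * (ε / 2) ^ 2 := by field_simp; norm_num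
      _ ≤ _ := by gcongr
  · rw [Set.indicator_of_notMem hω]
    positivity

theorem IsPrimitive.tendsto_limitDeviation (hu : IsPrimitive u) (hd : 0 < d) (z : Fin g → ℂ)
    {ε : ℝ} (hε : 0 < ε) : Tendsto (limitDeviation d g z (rho d g z) ε) atTop (𝓝 0) := by
  have h := (tendsto_limitVariance hd z).const_mul (4 / ε ^ 2)
  rw [mul_zero] at h
  refine squeeze_zero' (Eventually.of_forall fun L => measureReal_nonneg) ?_ h
  filter_upwards [Metric.tendsto_nhds.1 (tendsto_limitMean hd z) (ε / 2) (by positivity)] with L hL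
  exact hu.limitDeviation_le z hε (by rwa [dist_eq_norm] at hL)

/-- The limiting law of the normalised count, as the number of points tends to infinity. -/
noncomputable def limitLaw (d g : ℕ) [NeZero g] (z : Fin g → ℂ) (L : ℕ) : ProbabilityMeasure ℂ :=
  ⟨(cycleVectorLimit (L * d)).map fun v => normFunctional d g z L fun i => (v i : ℝ),
    Measure.isProbabilityMeasure_map (measurable_of_countable _).aemeasurable⟩

theorem integral_limitLaw (z : Fin g → ℂ) (L : ℕ) (f : BoundedContinuousFunction ℂ ℝ) :
    ∫ y, f y ∂(limitLaw d g z L : Measure ℂ)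
      = ∫ v, f (normFunctional d g z L fun i => (v i : ℝ)) ∂cycleVectorLimit (L * d) :=
  integral_map (measurable_of_countable _).aemeasurable f.continuous.aestronglyMeasurable

theorem IsPrimitive.tendsto_normCountLaw (hu : IsPrimitive u) (hd : 0 < d) (z : Fin g → ℂ)
    (L : ℕ) :
    Tendsto (fun n => normCountLaw (wordPow u d) g z n L) atTop (𝓝 (limitLaw d g z L)) := by
  rw [ProbabilityMeasure.tendsto_iff_forall_integral_tendsto]
  intro f
  rw [integral_limitLaw]
  refine (hu.tendsto_integral_cycleVector (L * d) (B := ‖f‖)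
    fun v => f.norm_coe_le_norm _).congr fun n => ?_
  refine Eq.trans ?_ (integral_map (measurable_sample _).aemeasurable
    f.continuous.aestronglyMeasurable).symm
  simp only [normCount_wordPow u hd]

theorem IsPrimitive.tendsto_limitLaw (hu : IsPrimitive u) (hd : 0 < d) (z : Fin g → ℂ) :
    Tendsto (limitLaw d g z) atTop (𝓝 (diracProba (rho d g z))) := by
  rw [ProbabilityMeasure.tendsto_iff_forall_integral_tendsto]
  intro f
  have hdirac : ∫ y, f y ∂(diracProba (rho d g z) : Measure ℂ) = f (rho d g z) :=
    integral_dirac _ _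
  rw [hdirac, Metric.tendsto_nhds]
  intro δ hδ
  obtain ⟨η, hη, hf⟩ := Metric.continuousAt_iff.1 (f.continuous.continuousAt (x := rho d g z))
    (δ / 2) (by positivity)
  -- Outside the deviation event the distance is only known to be at most the threshold, whereas
  -- continuity asks for less than `η`; hence `η / 2`.
  have hdev := ((hu.tendsto_limitDeviation hd z (ε := η / 2) (by positivity)).const_mul
    (2 * ‖f‖)).const_add (δ / 2)
  rw [mul_zero, add_zero] at hdev
  filter_upwards [hdev.eventually_lt_const (half_lt_self hδ)] with L hL
  have hi : Integrable (fun v : Fin (L * d) → ℕ => f (normFunctional d g z L fun i => (v i : ℝ)))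
      (cycleVectorLimit (L * d)) :=
    Integrable.of_bound (measurable_of_countable _).aestronglyMeasurable ‖f‖
      (ae_of_all _ fun v => f.norm_coe_le_norm _)
  have hS : MeasurableSet {v : Fin (L * d) → ℕ |
      η / 2 < ‖normFunctional d g z L (fun i => (v i : ℝ)) - rho d g z‖} :=
    (Set.to_countable _).measurableSet
  have hind : Integrable (fun v => 2 * ‖f‖ * Set.indicator {v : Fin (L * d) → ℕ |
      η / 2 < ‖normFunctional d g z L (fun i => (v i : ℝ)) - rho d g z‖} (1 : (Fin (L * d) → ℕ) → ℝ) v)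
      (cycleVectorLimit (L * d)) :=
    ((integrable_const (1 : ℝ)).indicator hS).const_mul _
  rw [integral_limitLaw, Real.dist_eq]
  refine lt_of_le_of_lt ?_ hL
  have hconst : f (rho d g z) = ∫ _, f (rho d g z) ∂cycleVectorLimit (L * d) := by simp
  have hbound : δ / 2 + 2 * ‖f‖ * limitDeviation d g z (rho d g z) (η / 2) L
      = ∫ v, (δ / 2 + 2 * ‖f‖ * Set.indicator {v : Fin (L * d) → ℕ |
        η / 2 < ‖normFunctional d g z L (fun i => (v i : ℝ)) - rho d g z‖} 1 v)
        ∂cycleVectorLimit (L * d) := by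
    rw [integral_add (integrable_const _) hind, integral_const_mul, integral_indicator_one hS]
    simp [limitDeviation]
  rw [hconst, ← integral_sub hi (integrable_const _), hbound, ← Real.norm_eq_abs]
  refine (norm_integral_le_integral_norm _).trans (integral_mono ?_ ?_ fun v => ?_)
  · exact (hi.sub (integrable_const _)).norm
  · exact (integrable_const _).add hind
  · simp only [Real.norm_eq_abs]
    by_cases hv : v ∈ {v : Fin (L * d) → ℕ |
        η / 2 < ‖normFunctional d g z L (fun i => (v i : ℝ)) - rho d g z‖}
    · rw [Set.indicator_of_mem hv, Pi.one_apply, mul_one]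
      have h1 := f.dist_le_two_norm (normFunctional d g z L fun i => (v i : ℝ)) (rho d g z)
      rw [Real.dist_eq] at h1
      linarith
    · rw [Set.indicator_of_notMem hv, mul_zero, add_zero]
      rw [Set.mem_ofPred_eq, not_lt] at hv
      have h1 := hf (x := normFunctional d g z L fun i => (v i : ℝ))
        (by rw [dist_eq_norm]; linarith)
      rw [Real.dist_eq] at h1
      exact h1.le

end PrimitiveRoot

end RandomWord

/-! ### The three modes of convergence. -/

theorem mainTheorem4 (w : List RandomWord.Letter) (d : ℕ) (hd : RandomWord.HasExponent w d)
    (g : ℕ) [NeZero g] (z : Fin g → ℂ) :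
    -- convergence in distribution
    RandomWord.IteratedLimit (fun n L => RandomWord.normCountLaw w g z n L)
        (diracProba (RandomWord.rho d g z)) ∧
    -- convergence in expectation
    RandomWord.IteratedLimit (fun n L => ∫ ω, RandomWord.normCount w g z n L ω ∂(RandomWord.law n))
        (RandomWord.rho d g z) ∧
    -- convergence in probability
    (∀ ε : ℝ, 0 < ε →
      RandomWord.IteratedLimit
        (fun n L => (RandomWord.law n).real
          {ω | ε < ‖RandomWord.normCount w g z n L ω - RandomWord.rho d g z‖})
        0) := by
  obtain ⟨hd0, u, hu, rfl⟩ := hd.exists_primitive_root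
  refine ⟨⟨RandomWord.limitLaw d g z, fun L _ => hu.tendsto_normCountLaw hd0 z L,
    hu.tendsto_limitLaw hd0 z⟩, ⟨RandomWord.limitMean d g z, fun L _ => ?_,
    RandomWord.tendsto_limitMean hd0 z⟩, fun ε hε =>
    ⟨RandomWord.limitDeviation d g z (RandomWord.rho d g z) ε, fun L _ => ?_,
      hu.tendsto_limitDeviation hd0 z hε⟩⟩
  · simp only [RandomWord.normCount_wordPow u hd0]
    exact hu.tendsto_integral_normFunctional z L
  · simp only [RandomWord.normCount_wordPow u hd0]
    exact hu.tendsto_deviation z _ ε L
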